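/- Let $a<b$, $\mathbb N=\{1,2,\dots\}$, and let $\mathcal C$ be the space of continuous functions $[a,b]\to\mathbb R$ with the uniform topology and its Borel $\sigma$-algebra; a random continuous function is a random element of $\mathcal C$. Let $\mathcal B$ be the law on $\mathcal C$ of standard (rate one) Brownian motion on $[a,b]$ started from $0$ at time $a$. **Quilts.** Let $\overline F=(F_i)_{i\in\mathbb N}$ be a sequence in $\mathcal C$ (the fabrics) and $S=\{s_1<\dots<s_N\}\subset[a,b]$ a finite set (the stitch points); put $s_0=a$, $s_{N+1}=b$. Then $\mathrm{Quilt}[\overline F,S]$ is the continuous function on $[a,b]$ that equals $F_i+v_i$ on $[s_{i-1},s_i]$ for $1\le i\le N+1$, where $v_1=0$ and $v_2,\dots,v_{N+1}$ are the constants that make it continuous. **Comparison.** Let $\beta\ge1$ and $h:J\to[0,1]$. A collection $(Y_j)_{j\in J}$ of random continuous functions *uniformly withstands $L^{\beta-}$-comparison to Brownian motion above scale $h$* if for every $\eta\in(0,1-\beta^{-1})$ there is a finite constant $C_0$, depending neither on $j$ nor on $A$, such that $$\mathbb P\big(Y_j(\cdot)-Y_j(a)\in A\big)\le C_0\,\mathcal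 B(A)^{1-\beta^{-1}-\eta}$$ for all $j\in J$ and all measurable sets $A\subseteq\{f\in\mathcal C: f(a)=0\}$ with $\mathcal B(A)\ge h(j)$. **Quiltability.** Let $\mathcal I$ be a set, $\beta_1,\beta_3,\beta_4>0$ and $\beta_2\ge1$. A collection $\{X_{n,\alpha}:(n,\alpha)\in\mathbb N\times\mathcal I\}$ of random continuous functions on a probability space $(\Omega,\mathbb P)$ is *uniformly Brownian motion patchwork $(\beta_1,\beta_2,\beta_3,\beta_4)$-quiltable* if there are $g>0$ and sequences $p,q:\mathbb N\to[0,1]$ such that, for each $\varepsilon>0$, $p_j\le j^{-\beta_1+\varepsilon}$ and $q_j\le j^{-\beta_3+\varepsilon}$ for all sufficiently large $j$, and if, on some extension of $(\Omega,\mathbb P)$ (a probability space with a measure preserving map to it), there are for each $(n,\alpha)$ an event $E_{n,\alpha}$, random continuous functions $\overline F_{n,\alpha}=(F_{n,\alpha;i})_{i\in\mathbb N}$ and a random finite set $S_{n,\alpha}\subset[a,b]$ such that 1. $\mathbb P(E_{n,\alpha})\le q_n$ for all $(n,\alpha)$; 2. the collection $\{F_{n,\alpha;i}:(n,\alpha,i)\in\mathbb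 N\times\mathcal I\times\mathbb N\}$ uniformly withstands $L^{\beta_2-}$-comparison to Brownian motion above scale $(n,\alpha,i)\mapsto\exp(-g\,n^{\beta_4})$; 3. $\mathbb P(|S_{n,\alpha}|\ge\ell)\le p_\ell$ for all $(n,\alpha)$ and $\ell\in\mathbb N$; 4. almost surely, if $E_{n,\alpha}$ does not occur then $X_{n,\alpha}=\mathrm{Quilt}[\overline F_{n,\alpha},S_{n,\alpha}]$ on $[a,b]$. A collection $\{X_\alpha:\alpha\in\mathcal I\}$ (without index $n$) is *uniformly Brownian motion patchwork $(\beta_1,\beta_2,\infty,\infty)$-quiltable* if the same holds without error events and at scale zero: there is $p:\mathbb N\to[0,1]$ as above and, on some extension of the probability space, there are for each $\alpha$ random continuous functions $\overline F_\alpha=(F_{\alpha;i})_{i\in\mathbb N}$ and a random finite set $S_\alpha\subset[a,b]$ such that $\{F_{\alpha;i}:(\alpha,i)\in\mathcal I\times\mathbb N\}$ uniformly withstands $L^{\beta_2-}$-comparison to Brownian motion above scale $0$, $\mathbb P(|S_\alpha|\ge\ell)\le p_\ell$ for all $\alpha$ and $\ell\in\mathbb N$, and $X_\alpha=\mathrm{Quilt}[\overline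 F_\alpha,S_\alpha]$ almost surely for every $\alpha$. **Proposition 6.8.** Let $\beta_1,\beta_3,\beta_4>0$ and $\beta_2\ge1$. Suppose that the collection $\{X_{n,\alpha}:(n,\alpha)\in\mathbb N\times\mathcal I\}$ of random continuous functions on $[a,b]$ is uniformly Brownian motion patchwork $(\beta_1,\beta_2,\beta_3,\beta_4)$-quiltable, and that $(X_{n,\alpha})_{n\in\mathbb N}$ is tight in $\mathcal C$ for each $\alpha\in\mathcal I$. Let $\{X_{\infty,\alpha}\}_{\alpha\in\mathcal I}$ be a collection of weak limit points: random continuous functions on a probability space such that, for each $\alpha$, some subsequence of $(X_{n,\alpha})_{n\in\mathbb N}$ converges in distribution in $\mathcal C$ to $X_{\infty,\alpha}$. Then $\{X_{\infty,\alpha}\}_{\alpha\in\mathcal I}$ is uniformly Brownian motion patchwork $(\beta_1,\beta_2,\infty,\infty)$-quiltable. -/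

import Mathlib

open MeasureTheory ProbabilityTheory Filter Topology

namespace BrownianQuilt

/-- The space of continuous functions `[a,b] → ℝ`, with the uniform topology. -/
abbrev PathSpace (a b : ℝ) : Type := C(Set.Icc a b, ℝ)

/-- The space of continuous functions `[a,b] → ℝ` carries its Borel σ-algebra. -/
instance instMeasurableSpacePath (a b : ℝ) : MeasurableSpace (PathSpace a b) := borel _

instance instBorelSpacePath (a b : ℝ) : BorelSpace (PathSpace a b) := ⟨rfl⟩

/-- The left endpoint of `[a,b]`, as a point of `[a,b]`. -/
def leftPt {a b : ℝ} (hab : a < b) : Set.Icc a b := ⟨a, Set.left_mem_Icc.2 hab.le⟩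

/-- The continuous functions on `[a,b]` that vanish at `a`. -/
def pinned {a b : ℝ} (hab : a < b) : Set (PathSpace a b) := {f | f (leftPt hab) = 0}

/-- The vertical shift `f(·) - f(a)`. -/
def vshift {a b : ℝ} (hab : a < b) (f : PathSpace a b) : PathSpace a b :=
  f - ContinuousMap.const _ (f (leftPt hab))

/-- `W` is the law of standard (rate one) Brownian motion on `[a,b]` started from `0` at time `a`.
There is exactly one such measure: it is the law of a continuous process that starts at `0` and has
independent increments, the increment from `s` to `t` being centred Gaussian of variance `t - s`. -/
structure IsBrownianLaw {a b : ℝ} (hab : a < b) (W : Measure (PathSpace a b)) : Prop where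
  start : ∀ᵐ f ∂W, f ∈ pinned hab
  indep : HasIndepIncrements (fun (t : Set.Icc a b) (f : PathSpace a b) => f t) W
  gaussian : ∀ s t : Set.Icc a b, s ≤ t →
    HasLaw (fun f : PathSpace a b => f t - f s) (gaussianReal 0 (Real.toNNReal ((t : ℝ) - s))) W

/-- The collection `Y j`, `j : J`, of random continuous functions on `[a,b]` uniformly withstands
`L^{β-}`-comparison to Brownian motion above scale `h`: with `W` the law of Brownian motion
on `[a,b]`, for every `η ∈ (0, 1 - 1/β)` there is a constant `C₀`, depending neither on `j` nor on
`A`, with `ℙ(Y_j(·) - Y_j(a) ∈ A) ≤ C₀ W(A)^{1 - 1/β - η}` for all `j` and all measurable sets `A`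
of continuous functions vanishing at `a` with `W(A) ≥ h(j)`.
(As the Brownian law is unique and exists, `∃ W` merely introduces it.) -/
def UniformlyWithstandsComparison {a b : ℝ} (hab : a < b) {Ω J : Type*} [MeasurableSpace Ω]
    (P : Measure Ω) (β : ℝ) (h : J → ℝ) (Y : J → Ω → PathSpace a b) : Prop :=
  ∃ W : Measure (PathSpace a b), IsBrownianLaw hab W ∧
    ∀ η : ℝ, 0 < η → η < 1 - β⁻¹ → ∃ C₀ : ℝ, ∀ (j : J) (A : Set (PathSpace a b)),
      MeasurableSet A → A ⊆ pinned hab → h j ≤ W.real A →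
        P.real {ω | vshift hab (Y j ω) ∈ A} ≤ C₀ * W.real A ^ (1 - β⁻¹ - η)

/-- A random finite subset of `[a,b]`: the number of its points in any Borel set is a random
variable. -/
structure IsRandomFiniteSubset (a b : ℝ) {Ω : Type*} [MeasurableSpace Ω]
    (S : Ω → Finset ℝ) : Prop where
  subset : ∀ ω, (S ω : Set ℝ) ⊆ Set.Icc a b
  measurable_count : ∀ U : Set ℝ, MeasurableSet U →
    Measurable (fun ω => ((S ω : Set ℝ) ∩ U).ncard)

/-- For `S = {s_1 < ⋯ < s_N}` and the conventions `s_0 = a`, `s_{N+1} = b`, the point `s_i`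
(for `i ≤ N + 1`). -/
noncomputable def node (a b : ℝ) (S : Finset ℝ) : ℕ → ℝ
  | 0 => a
  | i + 1 => (S.sort (· ≤ ·)).getD i b

/-- The continuous function `X` on `[a,b]` is the quilt made from the fabric sequence `F` and the
finite set `S = {s_1 < ⋯ < s_N}` of stitch points. The fabrics are numbered from `0`, so `F i` is
the fabric of the patch `[s_i, s_{i+1}]`, `0 ≤ i ≤ N`; on that patch `X` is `F i` plus a constant
`v i`, with `v 0 = 0`. As `X` is continuous, it is determined by `F` and `S`. -/
def IsQuilt {a b : ℝ} (F : ℕ → PathSpace a b) (S : Finset ℝ) (X : PathSpace a b) : Prop :=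
  ∃ v : ℕ → ℝ, v 0 = 0 ∧ ∀ i ≤ S.card, ∀ x : Set.Icc a b,
    node a b S i ≤ x → (x : ℝ) ≤ node a b S (i + 1) → X x = F i x + v i

/-- A sequence `p_1, p_2, …` in `[0,1]` such that, for each `ε > 0`, `p_j ≤ j^{-β+ε}` for all
sufficiently large `j`. -/
def HasPolynomialDecay (p : ℕ+ → ℝ) (β : ℝ) : Prop :=
  (∀ j, p j ∈ Set.Icc (0 : ℝ) 1) ∧
    ∀ ε : ℝ, 0 < ε → ∀ᶠ j : ℕ+ in atTop, p j ≤ ((j : ℕ) : ℝ) ^ (-β + ε)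

universe u

/-- The collection `X n α`, `(n, α) ∈ {1,2,…} × I`, of random continuous functions on `[a,b]`,
defined under the law `P`, is uniformly Brownian motion patchwork `(β₁,β₂,β₃,β₄)`-quiltable.
As usual, error events, fabrics and stitch points may use additional randomness: they live on a
probability space `(Ω', P')` that extends `(Ω, P)` through a measure preserving map `π`. -/
def IsUniformlyQuiltable {a b : ℝ} (hab : a < b) {Ω : Type u} [MeasurableSpace Ω] {I : Type*}
    (P : Measure Ω) (X : ℕ+ → I → Ω → PathSpace a b) (β₁ β₂ β₃ β₄ : ℝ) : Prop :=
  ∃ (p q : ℕ+ → ℝ) (g : ℝ), HasPolynomialDecay p β₁ ∧ HasPolynomialDecay q β₃ ∧ 0 < g ∧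
  ∃ (Ω' : Type u) (_ : MeasurableSpace Ω') (P' : Measure Ω') (π : Ω' → Ω),
    MeasurePreserving π P' P ∧
  ∃ (E : ℕ+ → I → Set Ω') (F : ℕ+ → I → ℕ → Ω' → PathSpace a b) (S : ℕ+ → I → Ω' → Finset ℝ),
    (∀ n α, MeasurableSet (E n α) ∧ P'.real (E n α) ≤ q n) ∧
    (∀ n α i, Measurable (F n α i)) ∧
    UniformlyWithstandsComparison hab P' β₂
      (fun j : ℕ+ × I × ℕ => Real.exp (-(g * ((j.1 : ℕ) : ℝ) ^ β₄)))
      (fun j => F j.1 j.2.1 j.2.2) ∧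
    (∀ n α, IsRandomFiniteSubset a b (S n α)) ∧
    (∀ n α (l : ℕ+), P'.real {ω | (l : ℕ) ≤ (S n α ω).card} ≤ p l) ∧
    (∀ n α, ∀ᵐ ω ∂P', ω ∉ E n α → IsQuilt (fun i => F n α i ω) (S n α ω) (X n α (π ω)))

/-- The collection `X α`, `α ∈ I`, of random continuous functions on `[a,b]` (the case `n = ∞`) is
uniformly Brownian motion patchwork `(β₁,β₂,∞,∞)`-quiltable: there is no error event, and the
comparison to Brownian motion holds above scale zero, that is for all measurable sets. -/
def IsUniformlyQuiltableLimit {a b : ℝ} (hab : a < b) {Ω : Type u} [MeasurableSpace Ω] {I : Type*}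
    (P : Measure Ω) (X : I → Ω → PathSpace a b) (β₁ β₂ : ℝ) : Prop :=
  ∃ p : ℕ+ → ℝ, HasPolynomialDecay p β₁ ∧
  ∃ (Ω' : Type u) (_ : MeasurableSpace Ω') (P' : Measure Ω') (π : Ω' → Ω),
    MeasurePreserving π P' P ∧
  ∃ (F : I → ℕ → Ω' → PathSpace a b) (S : I → Ω' → Finset ℝ),
    (∀ α i, Measurable (F α i)) ∧
    UniformlyWithstandsComparison hab P' β₂ (fun _ : I × ℕ => 0) (fun j => F j.1 j.2) ∧
    (∀ α, IsRandomFiniteSubset a b (S α)) ∧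
    (∀ α (l : ℕ+), P'.real {ω | (l : ℕ) ≤ (S α ω).card} ≤ p l) ∧
    (∀ α, ∀ᵐ ω ∂P', IsQuilt (fun i => F α i ω) (S α ω) (X α (π ω)))

end BrownianQuilt

/-!
Let `β₂ > 1`; for `β₂ = 1` the comparison condition is void. Record a quilt by its *code*: the path,
the pinned fabrics, the number `N` of stitch points and the nodes `s_0 ≤ s_1 ≤ ⋯`. Along the
subsequence for which `X n α` converges, the laws of the codes are tight: the path by assumption,
each fabric because it is dominated by Brownian motion, `N` by its tail bound, and the nodes by
compactness. A limit `μ` of these laws has the law of `X_lim α` as its path marginal, inherits the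
bound on the tail of `N`, has fabrics obeying the comparison at scale zero, and is carried by codes
of quilts, a closed condition (`IsBrownianLaw.exists_limit_code`).

The difficulty is that nodes may merge in the limit. The fabrics of the patches that collapse are
then to be skipped, and the fabric that ends up at place `i` is `G_K` with a random index `K`, so
that the comparison for each `G_k` does not give a comparison for `G_K`. Moreover, the first patch
may collapse. The code is therefore repaired as follows. Let `U` be uniform on `0, …, N`,
independent of the rest. The path is cut at `U` additional points just after `a`, and the fabrics of
the patches of positive length follow after `U` places. Given the code, a fabric with index `K ≤ N`
then lands at place `i` with probability at most `1 / (N + 1)`. Hence the comparison at place `i`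
costs
`∑ k, min (ℙ (N ≥ k)) (C W(A)^θ) / (k + 1) ≤ (∑ k, ℙ (N ≥ k)^s / (k + 1)) (C W(A)^θ)^(1 - s)`, where
`s > 0` is as small as desired and the sum converges since `ℙ (N ≥ k)` decays like a power of `k`
(`prod_shifted_le`).

The additional fabrics (and those beyond the last patch) have to agree with the first relevant
fabric `G_K` on a short time interval. They are obtained by following `G_K` up to a time `d c` and
then an independent Brownian path. Since the initial germ of Brownian motion is trivial, a finite
measure that is absolutely continuous to the Brownian law becomes nearly a multiple of it if all but a
very short initial part of the path is replaced by an independent Brownian path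
(`IsBrownianLaw.exists_prod_splice_le`). The time `d c` is chosen separately for each value `c` of
the pair formed by `K` and a lower bound for the length of the first patch, with an error `2⁻ᶜ`,
so that the errors can be summed (`IsBrownianLaw.prod_filler_le`).

The repaired quilt lives on a space made from the law `μ`. A regular conditional law and one
additional uniform variable move it to an extension of the space on which `X_lim α` is defined
(`exists_transfer`). It has at most `2 N + 1` stitch points, which does not affect the decay
exponent of their tail.
-/

namespace BrownianQuilt

open scoped ENNReal

universe u

variable {a b : ℝ}

/-! ### Splicing paths -/

/-- The path `f` stopped at time `c`. -/
def stopAt (c : Set.Icc a b) (f : PathSpace a b) : PathSpace a b :=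
  f.comp ⟨fun x => min x c, by fun_prop⟩

/-- The increments of the path `f` after time `c`: the path that vanishes up to time `c` and equals
`f - f c` afterwards. -/
def afterPart (c : Set.Icc a b) (f : PathSpace a b) : PathSpace a b :=
  f.comp ⟨fun x => max x c, by fun_prop⟩ - ContinuousMap.const _ (f c)

/-- The path that follows `f` up to time `c` and has the increments of `g` from then on. -/
def splice (c : Set.Icc a b) (f g : PathSpace a b) : PathSpace a b := stopAt c f + afterPart c g

@[simp] lemma stopAt_apply (c x : Set.Icc a b) (f : PathSpace a b) :
    stopAt c f x = f (min x c) := rfl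

@[simp] lemma afterPart_apply (c x : Set.Icc a b) (f : PathSpace a b) :
    afterPart c f x = f (max x c) - f c := rfl

lemma splice_apply (c x : Set.Icc a b) (f g : PathSpace a b) :
    splice c f g x = f (min x c) + (g (max x c) - g c) := rfl

lemma splice_apply_of_le {c x : Set.Icc a b} (h : x ≤ c) (f g : PathSpace a b) :
    splice c f g x = f x := by
  simp [splice_apply, min_eq_left h, max_eq_right h]

lemma splice_self (c : Set.Icc a b) (f : PathSpace a b) : splice c f f = f := by
  ext x
  rcases le_total x c with h | h
  · exact splice_apply_of_le h f f
  · simp [splice_apply, min_eq_right h, max_eq_left h]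

lemma continuous_stopAt (c : Set.Icc a b) : Continuous (stopAt c) :=
  ContinuousMap.continuous_precomp _

lemma continuous_afterPart (c : Set.Icc a b) : Continuous (afterPart c) :=
  (ContinuousMap.continuous_precomp _).sub
    ((ContinuousMap.continuous_const').comp (continuous_eval_const c))

lemma measurable_stopAt (c : Set.Icc a b) : Measurable (stopAt c) :=
  (continuous_stopAt c).measurable

lemma measurable_afterPart (c : Set.Icc a b) : Measurable (afterPart c) :=
  (continuous_afterPart c).measurable

lemma measurable_splice (c : Set.Icc a b) :
    Measurable (fun p : PathSpace a b × PathSpace a b => splice c p.1 p.2) :=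
  ((measurable_stopAt c).comp measurable_fst).add ((measurable_afterPart c).comp measurable_snd)

lemma isClosed_pinned (hab : a < b) : IsClosed (pinned hab) :=
  isClosed_eq (continuous_eval_const _) continuous_const

lemma measurable_eval (x : Set.Icc a b) : Measurable (fun f : PathSpace a b => f x) :=
  (continuous_eval_const x).measurable

lemma leftPt_le (hab : a < b) (x : Set.Icc a b) : leftPt hab ≤ x := x.2.1

lemma splice_mem_pinned {hab : a < b} {f g : PathSpace a b} (c : Set.Icc a b)
    (hf : f ∈ pinned hab) : splice c f g ∈ pinned hab := by
  have := splice_apply_of_le (leftPt_le hab c) f g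
  simpa [pinned, this] using hf

/-- Evaluation along a dense sequence of times embeds the path space into `ℕ → ℝ`, so that its Borel
σ-algebra is generated by the evaluations. -/
lemma measurableEmbedding_denseEval (hab : a < b) :
    have : Nonempty (Set.Icc a b) := ⟨leftPt hab⟩
    MeasurableEmbedding
      (fun (f : PathSpace a b) (n : ℕ) => f (TopologicalSpace.denseSeq (Set.Icc a b) n)) := by
  have : Nonempty (Set.Icc a b) := ⟨leftPt hab⟩
  refine Continuous.measurableEmbedding (continuous_pi fun n => continuous_eval_const _) ?_
  intro f g hfg
  have := (TopologicalSpace.denseRange_denseSeq (Set.Icc a b)).equalizer f.continuous g.continuous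
    hfg
  exact DFunLike.coe_injective this

lemma exists_monotone_nat_cover {T : Type*} [LinearOrder T] (s : Finset T) (hs : s.Nonempty) :
    ∃ t : ℕ → T, Monotone t ∧ ∃ n : ℕ, ∀ x ∈ s, ∃ i ≤ n, t i = x := by
  obtain ⟨n, hn⟩ : ∃ n, s.card = n + 1 := ⟨s.card - 1, by have := hs.card_pos; omega⟩
  refine ⟨fun k => s.orderEmbOfFin hn ⟨min k n, by omega⟩, ?_, n, fun x hx => ?_⟩
  · intro i j hij
    apply (s.orderEmbOfFin hn).monotone
    simp only [Fin.mk_le_mk]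
    omega
  · have : x ∈ Set.range (s.orderEmbOfFin hn) := by simpa using hx
    obtain ⟨i, rfl⟩ := this
    exact ⟨i, by omega, congrArg (s.orderEmbOfFin hn)
      (Fin.ext (min_eq_left (Nat.lt_succ_iff.1 i.2)))⟩

namespace IsBrownianLaw

variable {hab : a < b} {W : Measure (PathSpace a b)}

lemma isProbabilityMeasure (hW : IsBrownianLaw hab W) : IsProbabilityMeasure W :=
  ((hW.gaussian (leftPt hab) (leftPt hab) le_rfl).isProbabilityMeasure_iff).2 inferInstance

/-- Under the Brownian law the path up to a fixed time is independent of the increments after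
that time. -/
lemma indepFun_stopAt_afterPart (hW : IsBrownianLaw hab W) (c : Set.Icc a b) :
    IndepFun (stopAt c) (afterPart c) W := by
  classical
  have := hW.isProbabilityMeasure
  have : Nonempty (Set.Icc a b) := ⟨leftPt hab⟩
  set d := TopologicalSpace.denseSeq (Set.Icc a b) with hd
  set o := leftPt hab
  have key : IndepFun (fun (f : PathSpace a b) (n : ℕ) => f (min (d n) c) - f o)
      (fun (f : PathSpace a b) (n : ℕ) => f (max (d n) c) - f c) W := by
    refine IndepFun.process_indepFun_process
      (fun n => (measurable_eval _).sub (measurable_eval _))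
      (fun n => (measurable_eval _).sub (measurable_eval _)) fun I J => ?_
    set T : Finset (Set.Icc a b) :=
      {o, c} ∪ (I.image fun n => min (d n) c) ∪ (J.image fun n => max (d n) c) with hT
    obtain ⟨t, ht, n, hn⟩ := exists_monotone_nat_cover T ⟨o, by simp [hT]⟩
    choose! ix hix_le hix using hn
    have ho : o ∈ T := by simp [hT]
    have hc : c ∈ T := by simp [hT]
    have hI : ∀ k ∈ I, min (d k) c ∈ T := fun k hk =>
      Finset.mem_union_left _ (Finset.mem_union_right _ (Finset.mem_image_of_mem _ hk))
    have hJ : ∀ k ∈ J, max (d k) c ∈ T := fun k hk =>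
      Finset.mem_union_right _ (Finset.mem_image_of_mem _ hk)
    have ht0 : t 0 = o := le_antisymm (by rw [← hix o ho]; exact ht (Nat.zero_le _))
      (leftPt_le hab _)
    have hmeas : ∀ i, Measurable (fun f : PathSpace a b => f (t (i + 1)) - f (t i)) :=
      fun i => (measurable_eval _).sub (measurable_eval _)
    have hind := (hW.indep.nat ht).indepFun_finset (Finset.range (ix c)) (Finset.Ico (ix c) n)
      (by rw [Finset.disjoint_left]; intro k; simp; omega) hmeas
    -- the increments from `o` before `c`, and from `c` after `c`, are sums over disjoint blocks
    have := hind.comp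
      (φ := fun (y : Finset.range (ix c) → ℝ) (k : I) =>
        ∑ i : Finset.range (ix c), if (i : ℕ) < ix (min (d k) c) then y i else 0)
      (ψ := fun (y : Finset.Ico (ix c) n → ℝ) (k : J) =>
        ∑ i : Finset.Ico (ix c) n, if (i : ℕ) < ix (max (d k) c) then y i else 0)
      (by
        refine measurable_pi_lambda _ fun k => Finset.measurable_sum _ fun i _ => ?_
        split_ifs
        · exact measurable_pi_apply i
        · exact measurable_const)
      (by
        refine measurable_pi_lambda _ fun k => Finset.measurable_sum _ fun i _ => ?_
        split_ifs
        · exact measurable_pi_apply i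
        · exact measurable_const)
    convert this using 1
    · funext f k
      simp only [Function.comp_apply]
      rw [Finset.sum_coe_sort (Finset.range (ix c)) (fun i => if i < ix (min (d k) c) then
        f (t (i + 1)) - f (t i) else 0), ← Finset.sum_filter]
      have hk := hI k k.2
      by_cases hle : ix (min (d k) c) ≤ ix c
      · have : (Finset.range (ix c)).filter (fun i => i < ix (min (d k) c)) =
            Finset.range (ix (min (d k) c)) := by ext; simp; omega
        rw [this, Finset.sum_range_sub (fun i => f (t i)), hix _ hk, ht0]
      · have h1 : min (d k) c = c := by
          refine le_antisymm (min_le_right _ _) ?_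
          rw [← hix _ hk]; nth_rewrite 1 [← hix _ hc]; exact ht (by omega)
        have : (Finset.range (ix c)).filter (fun i => i < ix (min (d k) c)) =
            Finset.range (ix c) := by ext; simp; omega
        rw [this, Finset.sum_range_sub (fun i => f (t i)), hix _ hc, ht0, h1]
    · funext f k
      simp only [Function.comp_apply]
      rw [Finset.sum_coe_sort (Finset.Ico (ix c) n) (fun i => if i < ix (max (d k) c) then
        f (t (i + 1)) - f (t i) else 0), ← Finset.sum_filter]
      have hk := hJ k k.2
      have hkn := hix_le _ hk
      have : (Finset.Ico (ix c) n).filter (fun i => i < ix (max (d k) c)) =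
          Finset.Ico (ix c) (ix (max (d k) c)) := by ext; simp; omega
      rw [this]
      by_cases hle : ix c ≤ ix (max (d k) c)
      · rw [Finset.sum_Ico_sub (fun i => f (t i)) hle, hix _ hk, hix _ hc]
      · have h1 : max (d k) c = c := by
          refine le_antisymm ?_ (le_max_right _ _)
          rw [← hix _ hk]; nth_rewrite 2 [← hix _ hc]; exact ht (by omega)
        rw [Finset.Ico_eq_empty (by omega), h1]
        simp
  have hE := measurableEmbedding_denseEval hab
  have : Nonempty (PathSpace a b) := ⟨0⟩
  have key2 : IndepFun (fun (f : PathSpace a b) (n : ℕ) => stopAt c f (d n))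
      (fun (f : PathSpace a b) (n : ℕ) => afterPart c f (d n)) W := by
    refine key.congr ?_ (ae_of_all _ fun f => rfl)
    filter_upwards [hW.start] with f hf
    funext n
    have : f o = 0 := hf
    simp [this]
  have := key2.comp hE.measurable_invFun hE.measurable_invFun
  convert this using 1
  · funext f
    exact (hE.leftInverse_invFun (stopAt c f)).symm
  · funext f
    exact (hE.leftInverse_invFun (afterPart c f)).symm

end IsBrownianLaw


lemma measurableSet_splice (c : Set.Icc a b) {A : Set (PathSpace a b)} (hA : MeasurableSet A) :
    MeasurableSet {p : PathSpace a b × PathSpace a b | splice c p.1 p.2 ∈ A} :=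
  measurable_splice c hA

lemma measurableSet_splice_left (c : Set.Icc a b) (g : PathSpace a b) {A : Set (PathSpace a b)}
    (hA : MeasurableSet A) : MeasurableSet {f : PathSpace a b | splice c f g ∈ A} :=
  (measurable_splice c).comp (measurable_id.prodMk measurable_const) hA

/-- Splicing two independent Brownian paths yields a Brownian path. -/
lemma IsBrownianLaw.prod_splice {hab : a < b} {W : Measure (PathSpace a b)}
    (hW : IsBrownianLaw hab W) (c : Set.Icc a b) {A : Set (PathSpace a b)}
    (hA : MeasurableSet A) :
    (W.prod W) {p | splice c p.1 p.2 ∈ A} = W A := by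
  have := hW.isProbabilityMeasure
  have h1 := (indepFun_iff_map_prod_eq_prod_map_map (measurable_stopAt c).aemeasurable
    (measurable_afterPart c).aemeasurable).1 (hW.indepFun_stopAt_afterPart c)
  have hadd : MeasurableSet {q : PathSpace a b × PathSpace a b | q.1 + q.2 ∈ A} :=
    measurable_add hA
  have h2 : (W.map (stopAt c)).prod (W.map (afterPart c)) {q | q.1 + q.2 ∈ A} =
      (W.prod W) {p | splice c p.1 p.2 ∈ A} := by
    rw [Measure.map_prod_map _ _ (measurable_stopAt c) (measurable_afterPart c),
      Measure.map_apply ((measurable_stopAt c).prodMap (measurable_afterPart c)) hadd]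
    rfl
  rw [← h2, ← h1, Measure.map_apply ((measurable_stopAt c).prodMk (measurable_afterPart c)) hadd]
  congr 1
  ext f
  exact iff_of_eq (congrArg (· ∈ A) (splice_self c f))

/-- A bound by a power `θ ≤ 1` of the Brownian measure survives splicing with an independent
Brownian path, by Jensen's inequality. -/
lemma IsBrownianLaw.prod_splice_le {hab : a < b} {W : Measure (PathSpace a b)}
    (hW : IsBrownianLaw hab W) (c : Set.Icc a b) {ν : Measure (PathSpace a b)} [IsFiniteMeasure ν]
    {C : ℝ≥0∞} {θ : ℝ} (hθ : 0 < θ) (hθ1 : θ ≤ 1)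
    (hν : ∀ A, MeasurableSet A → ν A ≤ C * W A ^ θ) {A : Set (PathSpace a b)}
    (hA : MeasurableSet A) :
    (ν.prod W) {p | splice c p.1 p.2 ∈ A} ≤ C * W A ^ θ := by
  have := hW.isProbabilityMeasure
  have hm : Measurable (fun g => W {f | splice c f g ∈ A}) :=
    measurable_measure_prodMk_right (measurableSet_splice c hA)
  rw [Measure.prod_apply_symm (measurableSet_splice c hA)]
  calc ∫⁻ g, ν {f | splice c f g ∈ A} ∂W
      ≤ ∫⁻ g, C * W {f | splice c f g ∈ A} ^ θ ∂W :=
        lintegral_mono fun g => hν _ (measurableSet_splice_left c g hA)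
    _ = C * ∫⁻ g, W {f | splice c f g ∈ A} ^ θ ∂W := lintegral_const_mul _ (hm.pow_const θ)
    _ ≤ C * (∫⁻ g, W {f | splice c f g ∈ A} ∂W) ^ θ := by
        gcongr
        have := eLpNorm'_le_eLpNorm'_of_exponent_le hθ hθ1 W hm.aestronglyMeasurable
        simp only [eLpNorm', enorm_eq_self, ENNReal.rpow_one, div_one] at this
        rwa [one_div, ENNReal.rpow_inv_le_iff hθ] at this
    _ = C * W A ^ θ := by
        rw [← hW.prod_splice c hA, Measure.prod_apply_symm (measurableSet_splice c hA)]
        rfl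

lemma tendsto_afterPart {hab : a < b} {f : PathSpace a b} (hf : f ∈ pinned hab)
    {c : ℕ → Set.Icc a b} (hc : Tendsto c atTop (𝓝 (leftPt hab))) :
    Tendsto (fun n => afterPart (c n) f) atTop (𝓝 f) := by
  let H : C(Set.Icc a b × Set.Icc a b, ℝ) := ⟨fun p => f (max p.2 p.1) - f p.1, by fun_prop⟩
  have h1 : ∀ c, H.curry c = afterPart c f := fun c => by ext x; rfl
  have h2 : afterPart (leftPt hab) f = f := by
    ext x
    have h0 : f (leftPt hab) = 0 := hf
    simp [h0, max_eq_left (leftPt_le hab x)]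
  have := (H.curry.continuous.tendsto (leftPt hab)).comp hc
  simpa only [Function.comp_def, h1, h2] using this

/-- **The germ of a Brownian path carries no information.** If `ν` is absolutely continuous with
respect to the Brownian law, then following a `ν`-path for a short time and an independent Brownian
path afterwards is almost, in total variation, a Brownian path weighted by the mass of `ν`. -/
lemma IsBrownianLaw.exists_prod_splice_le {hab : a < b} {W : Measure (PathSpace a b)}
    (hW : IsBrownianLaw hab W) {ν : Measure (PathSpace a b)} [IsFiniteMeasure ν] (hν : ν ≪ W)
    {ε : ℝ≥0∞} (hε : ε ≠ 0) {t : ℝ} (ht : a < t) :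
    ∃ c : Set.Icc a b, a < c ∧ (c : ℝ) < t ∧ ∀ A, MeasurableSet A →
      (ν.prod W) {p | splice c p.1 p.2 ∈ A} ≤ ν Set.univ * W A + ε := by
  have := hW.isProbabilityMeasure
  set D := ν.rnDeriv W with hD
  have hDm : Measurable D := Measure.measurable_rnDeriv ν W
  obtain ⟨φ, hφ, -⟩ := (Measure.integrable_toReal_rnDeriv (μ := ν) (ν := W)
    ).exists_boundedContinuous_lintegral_sub_le (ε := ε / 2 / 2) (by simp [hε])
  -- times decreasing to `a`
  set r := min t b - a with hr
  have hr0 : 0 < r := by rw [hr]; simp only [sub_pos, lt_min_iff]; exact ⟨ht, hab⟩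
  have hrt : r ≤ t - a := by rw [hr]; gcongr; exact min_le_left _ _
  have hrb : r ≤ b - a := by rw [hr]; gcongr; exact min_le_right _ _
  have hdiv : ∀ n : ℕ, 0 < r / (n + 2) ∧ r / (n + 2) < r := fun n =>
    ⟨by positivity, div_lt_self hr0 (by have : (0 : ℝ) ≤ n := n.cast_nonneg; linarith)⟩
  let c : ℕ → Set.Icc a b := fun n => ⟨a + r / (n + 2), by
    have := hdiv n; constructor <;> linarith⟩
  have hc : Tendsto c atTop (𝓝 (leftPt hab)) := by
    rw [tendsto_subtype_rng]
    have h1 : Tendsto (fun n : ℕ => ((n : ℝ) + 2)) atTop atTop :=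
      tendsto_atTop_add_const_right _ _ tendsto_natCast_atTop_atTop
    have := (h1.const_div_atTop r).const_add a
    simpa [c, leftPt] using this
  have hlim : Tendsto (fun n => ∫⁻ f, ‖φ f - φ (afterPart (c n) f)‖ₑ ∂W) atTop (𝓝 0) := by
    have := tendsto_lintegral_of_dominated_convergence (μ := W)
      (F := fun n f => ‖φ f - φ (afterPart (c n) f)‖ₑ) (f := fun _ => 0)
      (fun _ => ENNReal.ofReal (2 * ‖φ‖))
      (fun n => (φ.continuous.measurable.sub
        (φ.continuous.measurable.comp (measurable_afterPart _))).enorm)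
      (fun n => ae_of_all _ fun f => by
        simp only [← ofReal_norm (φ f - _)]
        refine ENNReal.ofReal_le_ofReal ((norm_sub_le _ _).trans ?_)
        linarith [φ.norm_coe_le_norm f, φ.norm_coe_le_norm (afterPart (c n) f)])
      (by simp [-ENNReal.ofReal_mul])
      (by
        filter_upwards [hW.start] with f hf
        have h1 := (φ.continuous.tendsto f).comp (tendsto_afterPart hf hc)
        have h2 := (h1.const_sub (φ f)).enorm
        simpa using h2)
    simpa using this
  obtain ⟨n, hn⟩ := (hlim.eventually (eventually_le_nhds (b := ε / 2 / 2)
    (ENNReal.half_pos (ENNReal.half_pos hε).ne'))).exists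
  refine ⟨c n, ?_, ?_, fun A hA => ?_⟩
  · have := hdiv n; simp only [c]; linarith
  · have := hdiv n; simp only [c]; linarith
  have hψm : Measurable (fun f => φ (afterPart (c n) f)) :=
    φ.continuous.measurable.comp (measurable_afterPart _)
  set Δ : PathSpace a b → ℝ≥0∞ := fun f => ‖(D f).toReal - φ (afterPart (c n) f)‖ₑ with hΔ
  have hΔm : Measurable Δ := (hDm.ennreal_toReal.sub hψm).enorm
  have hΔle : ∫⁻ f, Δ f ∂W ≤ ε / 2 := by
    calc ∫⁻ f, Δ f ∂W ≤ ∫⁻ f, ‖(D f).toReal - φ f‖ₑ + ‖φ f - φ (afterPart (c n) f)‖ₑ ∂W := by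
          refine lintegral_mono fun f => ?_
          have : (D f).toReal - φ (afterPart (c n) f) =
              ((D f).toReal - φ f) + (φ f - φ (afterPart (c n) f)) := by ring
          simp only [hΔ, this]
          exact enorm_add_le _ _
      _ = _ := lintegral_add_left
          (hDm.ennreal_toReal.sub φ.continuous.measurable).enorm _
      _ ≤ ε / 2 / 2 + ε / 2 / 2 := add_le_add hφ hn
      _ = ε / 2 := ENNReal.add_halves _
  set ψ : PathSpace a b → ℝ≥0∞ := fun f => ENNReal.ofReal (φ f) with hψ
  have hψ'm : Measurable ψ := φ.continuous.measurable.ennreal_ofReal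
  have hDle : ∀ᵐ f ∂W, D f ≤ ψ (afterPart (c n) f) + Δ f := by
    filter_upwards [Measure.rnDeriv_lt_top ν W] with f hf
    rw [← hD] at hf
    simp only [hψ, hΔ, ← ofReal_norm]
    nth_rewrite 1 [← ENNReal.ofReal_toReal hf.ne]
    refine le_trans (ENNReal.ofReal_le_ofReal ?_) ENNReal.ofReal_add_le
    have := le_abs_self ((D f).toReal - φ (afterPart (c n) f))
    rw [← Real.norm_eq_abs] at this
    linarith
  have hψle : ∀ᵐ f ∂W, ψ (afterPart (c n) f) ≤ D f + Δ f := by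
    filter_upwards [Measure.rnDeriv_lt_top ν W] with f hf
    rw [← hD] at hf
    simp only [hψ, hΔ, ← ofReal_norm]
    nth_rewrite 1 [← ENNReal.ofReal_toReal hf.ne]
    refine le_trans (ENNReal.ofReal_le_ofReal ?_) ENNReal.ofReal_add_le
    have := neg_abs_le ((D f).toReal - φ (afterPart (c n) f))
    rw [← Real.norm_eq_abs] at this
    linarith
  have hψint : ∫⁻ f, ψ (afterPart (c n) f) ∂W ≤ ν Set.univ + ε / 2 := by
    calc _ ≤ ∫⁻ f, D f + Δ f ∂W := lintegral_mono_ae hψle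
      _ = ∫⁻ f, D f ∂W + ∫⁻ f, Δ f ∂W := lintegral_add_left hDm _
      _ ≤ _ := by rw [hD, Measure.lintegral_rnDeriv hν]; gcongr
  -- for a fixed continuation `g` the event depends on the initial part of `f` only
  have hg : ∀ g, ν {f | splice (c n) f g ∈ A} ≤
      W {f | splice (c n) f g ∈ A} * (ν Set.univ + ε / 2) + ε / 2 := by
    intro g
    set B := {f | splice (c n) f g ∈ A} with hB
    have hBm : MeasurableSet B := measurableSet_splice_left (c n) g hA
    set χ : PathSpace a b → ℝ≥0∞ :=
      Set.indicator {f | f + afterPart (c n) g ∈ A} 1 with hχ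
    have hχm : Measurable χ := measurable_one.indicator (measurable_add_const _ hA)
    have hχB : ∀ f, χ (stopAt (c n) f) = B.indicator 1 f := fun f => rfl
    have hindep := lintegral_mul_eq_lintegral_mul_lintegral_of_indepFun
      (hχm.comp (measurable_stopAt (c n))) (hψ'm.comp (measurable_afterPart (c n)))
      ((hW.indepFun_stopAt_afterPart (c n)).comp hχm hψ'm)
    calc ν B = ∫⁻ f in B, D f ∂W := (Measure.setLIntegral_rnDeriv hν B).symm
      _ ≤ ∫⁻ f in B, ψ (afterPart (c n) f) + Δ f ∂W :=
          lintegral_mono_ae (ae_restrict_of_ae hDle)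
      _ = ∫⁻ f in B, ψ (afterPart (c n) f) ∂W + ∫⁻ f in B, Δ f ∂W :=
          lintegral_add_right _ hΔm
      _ ≤ W B * (ν Set.univ + ε / 2) + ε / 2 := by
          refine add_le_add ?_ ((setLIntegral_le_lintegral _ _).trans hΔle)
          rw [← lintegral_indicator hBm]
          have : ∀ f, B.indicator (fun f => ψ (afterPart (c n) f)) f =
              ((χ ∘ stopAt (c n)) * (ψ ∘ afterPart (c n))) f := by
            intro f
            simp only [Pi.mul_apply, Function.comp_apply, hχB]
            by_cases hf : f ∈ B <;> simp [hf]
          simp_rw [this, hindep]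
          have h1 : ∫⁻ f, (χ ∘ stopAt (c n)) f ∂W = W B := by
            simp_rw [Function.comp_apply, hχB]
            exact lintegral_indicator_one hBm
          rw [h1]
          gcongr
          exact hψint
  have hm : Measurable (fun g => W {f | splice (c n) f g ∈ A}) :=
    measurable_measure_prodMk_right (measurableSet_splice (c n) hA)
  have hWA : ∫⁻ g, W {f | splice (c n) f g ∈ A} ∂W = W A := by
    rw [← hW.prod_splice (c n) hA, Measure.prod_apply_symm (measurableSet_splice (c n) hA)]
    rfl
  rw [Measure.prod_apply_symm (measurableSet_splice (c n) hA)]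
  calc _ ≤ ∫⁻ g, W {f | splice (c n) f g ∈ A} * (ν Set.univ + ε / 2) + ε / 2 ∂W :=
        lintegral_mono hg
    _ = W A * (ν Set.univ + ε / 2) + ε / 2 := by
        rw [lintegral_add_right _ measurable_const, lintegral_mul_const _ hm, hWA]
        simp
    _ = ν Set.univ * W A + (W A * (ε / 2) + ε / 2) := by ring
    _ ≤ ν Set.univ * W A + (1 * (ε / 2) + ε / 2) := by gcongr; exact prob_le_one
    _ = ν Set.univ * W A + ε := by rw [one_mul, ENNReal.add_halves]

/-! ### Comparison inequalities and weak limits -/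

lemma le_mul_rpow_of_forall_add {x C y : ℝ≥0∞} {θ : ℝ} (hC : C ≠ ∞)
    (h : ∀ δ : ℝ≥0∞, δ ≠ 0 → x ≤ C * (y + δ) ^ θ) : x ≤ C * y ^ θ := by
  have h1 : Tendsto (fun δ : ℝ≥0∞ => C * (y + δ) ^ θ) (𝓝[>] 0) (𝓝 (C * (y + 0) ^ θ)) := by
    refine ENNReal.Tendsto.const_mul ?_ (Or.inr hC)
    exact ((ENNReal.continuous_rpow_const.tendsto _).comp
      ((continuous_const.add continuous_id).tendsto 0)).mono_left nhdsWithin_le_nhds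
  rw [add_zero] at h1
  exact ge_of_tendsto h1 (eventually_mem_nhdsWithin.mono fun δ hδ => h δ (ne_of_gt hδ))

lemma exists_mul_rpow_le {C ε : ℝ≥0∞} {θ : ℝ} (hC : C ≠ ∞) (hθ : 0 < θ) (hε : ε ≠ 0) :
    ∃ δ : ℝ≥0∞, δ ≠ 0 ∧ C * δ ^ θ ≤ ε := by
  by_contra! h
  have : ε ≤ C * 0 ^ θ := le_mul_rpow_of_forall_add hC fun δ hδ => by
    rw [zero_add]; exact (h δ hδ).le
  rw [ENNReal.zero_rpow_of_pos hθ, mul_zero] at this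
  exact hε (le_antisymm this bot_le)

/-- The right endpoint of `[a,b]`, as a point of `[a,b]`. -/
def rightPt (hab : a < b) : Set.Icc a b := ⟨b, Set.right_mem_Icc.2 hab.le⟩

/-- There are events of arbitrarily small positive Brownian measure. -/
lemma IsBrownianLaw.exists_small {hab : a < b} {W : Measure (PathSpace a b)}
    (hW : IsBrownianLaw hab W) {ε : ℝ≥0∞} (hε : ε ≠ 0) :
    ∃ B : Set (PathSpace a b), MeasurableSet B ∧ W B ≠ 0 ∧ W B ≤ ε := by
  have := hW.isProbabilityMeasure
  have hlaw := hW.gaussian (leftPt hab) (rightPt hab) (leftPt_le hab _)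
  set G : ℕ → Set (PathSpace a b) := fun m =>
    {f | (m : ℝ) < f (rightPt hab) - f (leftPt hab)} with hG
  have hGm : ∀ m, MeasurableSet (G m) := fun m =>
    measurableSet_lt measurable_const ((measurable_eval _).sub (measurable_eval _))
  have hanti : Antitone G := fun m n hmn f (hf : (n : ℝ) < _) =>
    show (m : ℝ) < _ from lt_of_le_of_lt (Nat.cast_le.2 hmn) hf
  have hempty : ⋂ m, G m = ∅ := by
    ext f
    simp only [hG, Set.mem_iInter, Set.mem_ofPred_eq, Set.mem_empty_iff_false, iff_false, not_forall,
      not_lt]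
    exact exists_nat_ge _
  have hlim := tendsto_measure_iInter_atTop (μ := W) (fun m => (hGm m).nullMeasurableSet) hanti
    ⟨0, measure_ne_top _ _⟩
  rw [hempty, measure_empty] at hlim
  obtain ⟨m, hm⟩ := (hlim.eventually (eventually_le_nhds (pos_iff_ne_zero.2 hε))).exists
  refine ⟨G m, hGm m, ?_, hm⟩
  have hv : Real.toNNReal (((rightPt hab : Set.Icc a b) : ℝ) - (leftPt hab : Set.Icc a b)) ≠ 0 := by
    simp [rightPt, leftPt, hab]
  have h1 : W (G m) = gaussianReal 0
      (Real.toNNReal (((rightPt hab : Set.Icc a b) : ℝ) - (leftPt hab : Set.Icc a b)))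
      (Set.Ioi (m : ℝ)) := by
    rw [← hlaw.map_eq, Measure.map_apply_of_aemeasurable hlaw.aemeasurable measurableSet_Ioi]
    rfl
  rw [h1]
  intro h0
  have := gaussianReal_absolutelyContinuous' 0 hv h0
  simp at this

/-- A sequence of laws that eventually obeys a comparison to the Brownian law on every event of
positive Brownian measure is tight. -/
lemma IsBrownianLaw.isTightMeasureSet_of_comparison {hab : a < b} {W : Measure (PathSpace a b)}
    (hW : IsBrownianLaw hab W) {ν : ℕ → Measure (PathSpace a b)} [∀ k, IsProbabilityMeasure (ν k)]
    {C : ℝ≥0∞} (hC : C ≠ ∞) {θ : ℝ} (hθ : 0 < θ)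
    (hν : ∀ A, MeasurableSet A → W A ≠ 0 → ∀ᶠ k in atTop, ν k A ≤ C * W A ^ θ) :
    IsTightMeasureSet (Set.range ν) := by
  have := hW.isProbabilityMeasure
  rw [isTightMeasureSet_iff_exists_isCompact_measure_compl_le]
  intro ε hε
  obtain ⟨δ, hδ0, hδ⟩ := exists_mul_rpow_le hC hθ hε.ne'
  obtain ⟨B, hBm, hB0, hBδ⟩ := hW.exists_small (ENNReal.half_pos hδ0).ne'
  obtain ⟨K, hK, hKW⟩ := isTightMeasureSet_iff_exists_isCompact_measure_compl_le.1
    (isTightMeasureSet_singleton (μ := W)) (δ / 2) (ENNReal.half_pos hδ0)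
  have hev := hν (Kᶜ ∪ B) (hK.measurableSet.compl.union hBm)
    (fun h => hB0 (measure_mono_null Set.subset_union_right h))
  obtain ⟨k₀, hk₀⟩ := eventually_atTop.1 hev
  have hsingle : ∀ k, ∃ K, IsCompact K ∧ ν k Kᶜ ≤ ε := fun k => by
    obtain ⟨K, hK, h⟩ := isTightMeasureSet_iff_exists_isCompact_measure_compl_le.1
      (isTightMeasureSet_singleton (μ := ν k)) ε hε
    exact ⟨K, hK, h _ rfl⟩
  choose L hL hLν using hsingle
  refine ⟨K ∪ ⋃ k ∈ Finset.range k₀, L k,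
    hK.union ((Finset.range k₀).isCompact_biUnion fun k _ => hL k), ?_⟩
  rintro _ ⟨k, rfl⟩
  rcases lt_or_ge k k₀ with h | h
  · refine (measure_mono (Set.compl_subset_compl.2 ?_)).trans (hLν k)
    exact (Set.subset_biUnion_of_mem (u := L) (Finset.mem_coe.2 (Finset.mem_range.2 h))).trans
      Set.subset_union_right
  · calc ν k (K ∪ ⋃ k ∈ Finset.range k₀, L k)ᶜ ≤ ν k (Kᶜ ∪ B) := measure_mono
          ((Set.compl_subset_compl.2 Set.subset_union_left).trans Set.subset_union_left)
      _ ≤ C * W (Kᶜ ∪ B) ^ θ := hk₀ k h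
      _ ≤ C * δ ^ θ := by
          gcongr
          calc W (Kᶜ ∪ B) ≤ W Kᶜ + W B := measure_union_le _ _
            _ ≤ δ / 2 + δ / 2 := add_le_add (hKW _ rfl) hBδ
            _ = δ := ENNReal.add_halves δ
      _ ≤ ε := hδ

/-- If the laws `ν k` eventually obey a comparison to the Brownian law on every event of positive
Brownian measure, and `ν'` is dominated on open sets by their upper limits, then `ν'` obeys the
comparison on all events. -/
lemma IsBrownianLaw.comparison_of_limit {hab : a < b} {W : Measure (PathSpace a b)}
    (hW : IsBrownianLaw hab W) {ν : ℕ → Measure (PathSpace a b)} {ν' : Measure (PathSpace a b)}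
    {C : ℝ≥0∞} (hC : C ≠ ∞) {θ : ℝ} (hθ : 0 ≤ θ)
    (hν : ∀ A, MeasurableSet A → W A ≠ 0 → ∀ᶠ k in atTop, ν k A ≤ C * W A ^ θ)
    (hlim : ∀ U, IsOpen U → ∀ r : ℝ≥0∞, (∀ᶠ k in atTop, ν k U ≤ r) → ν' U ≤ r)
    (A : Set (PathSpace a b)) : ν' A ≤ C * W A ^ θ := by
  have := hW.isProbabilityMeasure
  refine le_mul_rpow_of_forall_add hC fun δ hδ => ?_
  obtain ⟨U, hAU, hU, hUW⟩ := A.exists_isOpen_le_add W (ENNReal.half_pos hδ).ne'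
  obtain ⟨B, hBm, hB0, hBδ⟩ := hW.exists_small (ENNReal.half_pos hδ).ne'
  refine (measure_mono hAU).trans (hlim U hU _ ?_)
  filter_upwards [hν (U ∪ B) (hU.measurableSet.union hBm)
    (fun h => hB0 (measure_mono_null Set.subset_union_right h))] with k hk
  calc ν k U ≤ ν k (U ∪ B) := measure_mono Set.subset_union_left
    _ ≤ C * W (U ∪ B) ^ θ := hk
    _ ≤ C * (W A + δ) ^ θ := by
        gcongr
        calc W (U ∪ B) ≤ W U + W B := measure_union_le _ _
          _ ≤ W A + δ / 2 + δ / 2 := add_le_add hUW hBδ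
          _ = W A + δ := by rw [add_assoc, ENNReal.add_halves]

/-- A set of measures on a countable product is tight if all its marginals are tight. -/
lemma isTightMeasureSet_pi {E : Type*} [TopologicalSpace E] [T2Space E] [MeasurableSpace E]
    [OpensMeasurableSpace E] {M : Set (Measure (ℕ → E))}
    (hM : ∀ i, IsTightMeasureSet ((fun ν : Measure (ℕ → E) => ν.map (fun x => x i)) '' M)) :
    IsTightMeasureSet M := by
  simp_rw [isTightMeasureSet_iff_exists_isCompact_measure_compl_le] at hM ⊢
  intro ε hε
  obtain ⟨ε', hε', hsum⟩ := ENNReal.exists_pos_sum_of_countable' hε.ne' ℕ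
  choose K hK hKM using fun i => hM i (ε' i) (hε' i)
  refine ⟨Set.univ.pi K, isCompact_univ_pi hK, fun ν hν => ?_⟩
  calc ν (Set.univ.pi K)ᶜ ≤ ν (⋃ i, {x | x i ∈ (K i)ᶜ}) := by
        refine measure_mono fun x hx => ?_
        simpa [Set.mem_pi] using hx
    _ ≤ ∑' i, ν {x | x i ∈ (K i)ᶜ} := measure_iUnion_le _
    _ ≤ ∑' i, ε' i := by
        refine ENNReal.tsum_le_tsum fun i => ?_
        have := hKM i _ ⟨ν, hν, rfl⟩
        rwa [Measure.map_apply (measurable_pi_apply i) (hK i).measurableSet.compl] at this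
    _ ≤ ε := hsum.le

/-! ### Codes of quilts -/

instance : PolishSpace (Set.Icc a b) := isClosed_Icc.polishSpace

/-- The data of a quilt: the path `X`, the fabrics `G 0, G 1, …`, the number `N` of stitch points
and the nodes `s_0 ≤ s_1 ≤ ⋯`. In contrast to the stitch points of a quilt the nodes may coincide,
which makes the codes of quilts a closed set. -/
abbrev QuiltCode (a b : ℝ) : Type := PathSpace a b × (ℕ → PathSpace a b) × ℕ × (ℕ → Set.Icc a b)

/-- The path of a quilt code. -/
abbrev QuiltCode.path (z : QuiltCode a b) : PathSpace a b := z.1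

/-- The fabrics of a quilt code. -/
abbrev QuiltCode.fabric (z : QuiltCode a b) : ℕ → PathSpace a b := z.2.1

/-- The number of stitch points of a quilt code, counted with multiplicity. -/
abbrev QuiltCode.num (z : QuiltCode a b) : ℕ := z.2.2.1

/-- The nodes of a quilt code. -/
abbrev QuiltCode.pos (z : QuiltCode a b) : ℕ → Set.Icc a b := z.2.2.2

/-- The code `z` describes a quilt, up to coinciding nodes: its fabrics vanish at `a`, its nodes
increase from `a` to `b`, and on each patch the path has the increments of the fabric. A point of
the patch is written `max s_i (min x s_{i+1})`. -/
def IsQuiltCode (hab : a < b) (z : QuiltCode a b) : Prop :=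
  (∀ i, z.fabric i ∈ pinned hab) ∧ z.pos 0 = leftPt hab ∧ (∀ i, z.pos i ≤ z.pos (i + 1)) ∧
  (∀ n, z.num = n → z.pos (n + 1) = rightPt hab) ∧
  ∀ i x, i ≤ z.num →
    z.path (max (z.pos i) (min x (z.pos (i + 1)))) - z.path (z.pos i) =
      z.fabric i (max (z.pos i) (min x (z.pos (i + 1)))) - z.fabric i (z.pos i)

lemma isClosed_isQuiltCode (hab : a < b) : IsClosed {z : QuiltCode a b | IsQuiltCode hab z} := by
  have hp : ∀ i, Continuous fun z : QuiltCode a b => z.pos i := fun i =>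
    (continuous_apply i).comp (continuous_snd.comp (continuous_snd.comp continuous_snd))
  have hn : Continuous fun z : QuiltCode a b => z.num :=
    continuous_fst.comp (continuous_snd.comp continuous_snd)
  have hf : ∀ i, Continuous fun z : QuiltCode a b => z.fabric i := fun i =>
    (continuous_apply i).comp (continuous_fst.comp continuous_snd)
  have hx : Continuous fun z : QuiltCode a b => z.path := continuous_fst
  simp only [IsQuiltCode, Set.ofPred_and, Set.ofPred_forall]
  refine ((isClosed_iInter fun i => (isClosed_pinned hab).preimage (hf i)).inter
    ((isClosed_eq (hp 0) continuous_const).inter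
    ((isClosed_iInter fun i => isClosed_le (hp i) (hp (i + 1))).inter
    ((isClosed_iInter fun n => ?_).inter
    (isClosed_iInter fun i => isClosed_iInter fun x => ?_)))))
  · exact isClosed_imp ((isOpen_discrete {n}).preimage hn) (isClosed_eq (hp _) continuous_const)
  · refine isClosed_imp ((isOpen_discrete (Set.Ici i)).preimage hn) (isClosed_eq ?_ ?_)
    · exact (hx.eval ((hp i).max (continuous_const.min (hp (i + 1))))).sub (hx.eval (hp i))
    · exact ((hf i).eval ((hp i).max (continuous_const.min (hp (i + 1))))).sub ((hf i).eval (hp i))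

lemma measurable_path : Measurable (QuiltCode.path : QuiltCode a b → _) := measurable_fst

lemma measurable_fabric (i : ℕ) : Measurable (fun z : QuiltCode a b => z.fabric i) :=
  (measurable_pi_apply i).comp (measurable_fst.comp measurable_snd)

lemma measurable_num : Measurable (QuiltCode.num : QuiltCode a b → _) :=
  measurable_fst.comp (measurable_snd.comp measurable_snd)

lemma measurable_pos (i : ℕ) : Measurable (fun z : QuiltCode a b => z.pos i) :=
  (measurable_pi_apply i).comp (measurable_snd.comp (measurable_snd.comp measurable_snd))

lemma continuous_fabric (i : ℕ) : Continuous (fun z : QuiltCode a b => z.fabric i) :=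
  (continuous_apply i).comp (continuous_fst.comp continuous_snd)

lemma continuous_num : Continuous (QuiltCode.num : QuiltCode a b → _) :=
  continuous_fst.comp (continuous_snd.comp continuous_snd)

/-! ### The nodes of a finite set -/

lemma node_succ_of_lt {S : Finset ℝ} {i : ℕ} (h : i < S.card) :
    node a b S (i + 1) = S.orderEmbOfFin rfl ⟨i, h⟩ := by
  rw [node, Finset.orderEmbOfFin_apply, List.getD_eq_getElem]
  rfl

lemma node_succ_of_le {S : Finset ℝ} {i : ℕ} (h : S.card ≤ i) : node a b S (i + 1) = b := by
  rw [node, List.getD_eq_default]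
  simpa using h

lemma node_mem_Icc (hab : a < b) {S : Finset ℝ} (hS : (S : Set ℝ) ⊆ Set.Icc a b) (i : ℕ) :
    node a b S i ∈ Set.Icc a b := by
  rcases i with _ | i
  · exact ⟨le_rfl, hab.le⟩
  · rcases lt_or_ge i S.card with h | h
    · rw [node_succ_of_lt h]
      exact hS (Finset.orderEmbOfFin_mem S rfl _)
    · rw [node_succ_of_le h]
      exact ⟨hab.le, le_rfl⟩

lemma node_le_node_succ (hab : a < b) {S : Finset ℝ} (hS : (S : Set ℝ) ⊆ Set.Icc a b) (i : ℕ) :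
    node a b S i ≤ node a b S (i + 1) := by
  rcases i with _ | i
  · exact (node_mem_Icc hab hS 1).1
  · rcases lt_or_ge (i + 1) S.card with h | h
    · rw [node_succ_of_lt h, node_succ_of_lt (by omega)]
      exact (S.orderEmbOfFin rfl).monotone (by simp)
    · rw [node_succ_of_le h]
      exact (node_mem_Icc hab hS _).2

lemma node_succ_le_iff {S : Finset ℝ} {i : ℕ} {t : ℝ} (ht : t < b) :
    node a b S (i + 1) ≤ t ↔ i < ((S : Set ℝ) ∩ Set.Iic t).ncard := by
  have hcard : ((S : Set ℝ) ∩ Set.Iic t).ncard =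
      (Finset.univ.filter fun j : Fin S.card => S.orderEmbOfFin rfl j ≤ t).card := by
    rw [← Finset.card_map (S.orderEmbOfFin rfl).toEmbedding, ← Set.ncard_coe_finset]
    congr 1
    ext x
    simp only [Set.mem_inter_iff, Finset.mem_coe, Set.mem_Iic, Finset.mem_map, Finset.mem_filter,
      Finset.mem_univ, true_and]
    constructor
    · rintro ⟨hx, hxt⟩
      have : x ∈ Set.range (S.orderEmbOfFin rfl) := by simpa using hx
      obtain ⟨j, rfl⟩ := this
      exact ⟨j, hxt, rfl⟩
    · rintro ⟨j, hj, rfl⟩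
      exact ⟨Finset.orderEmbOfFin_mem S rfl j, hj⟩
  rw [hcard]
  rcases lt_or_ge i S.card with h | h
  · rw [node_succ_of_lt h]
    constructor
    · intro hle
      have : Finset.Iic (⟨i, h⟩ : Fin S.card) ⊆
          Finset.univ.filter fun j : Fin S.card => S.orderEmbOfFin rfl j ≤ t := by
        intro j hj
        simp only [Finset.mem_filter, Finset.mem_univ, true_and]
        exact ((S.orderEmbOfFin rfl).monotone (Finset.mem_Iic.1 hj)).trans hle
      have := Finset.card_le_card this
      rw [Fin.card_Iic] at this
      exact this
    · intro hlt
      by_contra! hgt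
      have : (Finset.univ.filter fun j : Fin S.card => S.orderEmbOfFin rfl j ≤ t) ⊆
          Finset.Iio (⟨i, h⟩ : Fin S.card) := by
        intro j hj
        simp only [Finset.mem_filter, Finset.mem_univ, true_and] at hj
        exact Finset.mem_Iio.2 ((S.orderEmbOfFin rfl).lt_iff_lt.1 (hj.trans_lt hgt))
      have := Finset.card_le_card this
      rw [Fin.card_Iio] at this
      exact absurd hlt (not_lt.2 this)
  · rw [node_succ_of_le h]
    refine iff_of_false (not_le.2 ht) (not_lt.2 (le_trans ?_ h))
    exact (Finset.card_le_univ _).trans (by simp)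

lemma measurable_node (a b : ℝ) {Ω : Type*} [MeasurableSpace Ω] {S : Ω → Finset ℝ}
    (hS : IsRandomFiniteSubset a b S) (i : ℕ) : Measurable fun ω => node a b (S ω) i := by
  rcases i with _ | i
  · exact measurable_const
  refine measurable_of_Iic fun t => ?_
  rcases lt_or_ge t b with ht | ht
  · have : (fun ω => node a b (S ω) (i + 1)) ⁻¹' Set.Iic t =
        (fun ω => ((S ω : Set ℝ) ∩ Set.Iic t).ncard) ⁻¹' Set.Ioi i := by
      ext ω
      exact node_succ_le_iff ht
    rw [this]
    exact hS.measurable_count _ measurableSet_Iic (measurableSet_Ioi)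
  · have : (fun ω => node a b (S ω) (i + 1)) ⁻¹' Set.Iic t = Set.univ := by
      ext ω
      simp only [Set.mem_preimage, Set.mem_Iic, Set.mem_univ, iff_true]
      rcases lt_or_ge i (S ω).card with h | h
      · rw [node_succ_of_lt h]
        exact (hS.subset ω (Finset.orderEmbOfFin_mem _ rfl _)).2.trans ht
      · rw [node_succ_of_le h]
        exact ht
    rw [this]
    exact MeasurableSet.univ

lemma IsRandomFiniteSubset.measurable_card {Ω : Type*} [MeasurableSpace Ω] {S : Ω → Finset ℝ}
    (hS : IsRandomFiniteSubset a b S) : Measurable fun ω => (S ω).card := by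
  simpa using hS.measurable_count Set.univ MeasurableSet.univ

/-- The code of the quilt with path `X`, fabrics `F` (pinned at `a`) and stitch points `S`. -/
noncomputable def encode (hab : a < b) (F : ℕ → PathSpace a b) (S : Finset ℝ) (X : PathSpace a b) :
    QuiltCode a b :=
  (X, fun i => vshift hab (F i), S.card, fun i => Set.projIcc a b hab.le (node a b S i))

lemma vshift_apply (hab : a < b) (f : PathSpace a b) (x : Set.Icc a b) :
    vshift hab f x = f x - f (leftPt hab) := rfl

lemma vshift_mem_pinned (hab : a < b) (f : PathSpace a b) : vshift hab f ∈ pinned hab := by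
  simp [pinned, vshift_apply]

lemma measurable_vshift (hab : a < b) : Measurable (vshift hab) :=
  (continuous_id.sub ((ContinuousMap.continuous_const').comp (continuous_eval_const _))).measurable

lemma IsQuilt.isQuiltCode_encode {hab : a < b} {F : ℕ → PathSpace a b} {S : Finset ℝ}
    {X : PathSpace a b} (hS : (S : Set ℝ) ⊆ Set.Icc a b) (h : IsQuilt F S X) :
    IsQuiltCode hab (encode hab F S X) := by
  obtain ⟨v, -, hv⟩ := h
  have hpos : ∀ i, (((encode hab F S X).pos i : Set.Icc a b) : ℝ) = node a b S i := fun i => by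
    simp only [encode, QuiltCode.pos, Set.projIcc_of_mem hab.le (node_mem_Icc hab hS i)]
  have hmono : ∀ i, (encode hab F S X).pos i ≤ (encode hab F S X).pos (i + 1) := fun i => by
    rw [← Subtype.coe_le_coe, hpos, hpos]
    exact node_le_node_succ hab hS i
  refine ⟨fun i => vshift_mem_pinned hab _, ?_, hmono, ?_, ?_⟩
  · exact Subtype.ext (hpos 0)
  · rintro n rfl
    exact Subtype.ext ((hpos _).trans (node_succ_of_le le_rfl))
  · intro i x hi
    set s := (encode hab F S X).pos i with hs
    set t := (encode hab F S X).pos (i + 1) with ht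
    have hX : ∀ y : Set.Icc a b, s ≤ y → y ≤ t → X y = F i y + v i := fun y h1 h2 =>
      hv i hi y (by rw [← hpos]; exact h1) (by rw [← hpos]; exact h2)
    have h1 := hX s le_rfl (hmono i)
    have h2 := hX (max s (min x t)) (le_max_left _ _) (max_le (hmono i) (min_le_right _ _))
    simp only [encode, vshift_apply, QuiltCode.path, QuiltCode.fabric] at *
    rw [h1, h2]
    ring

lemma measurable_encode (hab : a < b) {Ω : Type*} [MeasurableSpace Ω] {F : ℕ → Ω → PathSpace a b}
    {S : Ω → Finset ℝ} {X : Ω → PathSpace a b} (hF : ∀ i, Measurable (F i))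
    (hS : IsRandomFiniteSubset a b S) (hX : Measurable X) :
    Measurable fun ω => encode hab (fun i => F i ω) (S ω) (X ω) :=
  hX.prodMk ((measurable_pi_lambda _ fun i => (measurable_vshift hab).comp (hF i)).prodMk
    (hS.measurable_card.prodMk (measurable_pi_lambda _ fun i =>
      (continuous_projIcc.measurable).comp (measurable_node a b hS i))))

/-! ### Weak limits of quilt codes -/

/-- A sequence of random quilt codes has tight laws if its paths have tight laws, its fabrics obey a
comparison to the Brownian law and its numbers of stitch points have a common tail bound. -/
lemma IsBrownianLaw.isTightMeasureSet_code {hab : a < b} {W : Measure (PathSpace a b)}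
    (hW : IsBrownianLaw hab W) {Ω : Type*} [MeasurableSpace Ω] {P : Measure Ω}
    [IsProbabilityMeasure P] {Z : ℕ → Ω → QuiltCode a b} (hZ : ∀ k, Measurable (Z k))
    (htight : IsTightMeasureSet (Set.range fun k => P.map fun ω => (Z k ω).path))
    {p : ℕ → ℝ≥0∞} (hp0 : Tendsto p atTop (𝓝 0)) (hp : ∀ k l, P {ω | l ≤ (Z k ω).num} ≤ p l)
    {C : ℝ≥0∞} (hC : C ≠ ∞) {θ : ℝ} (hθ : 0 < θ)
    (hcomp : ∀ i A, MeasurableSet A → W A ≠ 0 →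
      ∀ᶠ k in atTop, P {ω | (Z k ω).fabric i ∈ A} ≤ C * W A ^ θ) :
    IsTightMeasureSet (Set.range fun k => P.map (Z k)) := by
  refine IsTightMeasureSet.prodMk ?_ (IsTightMeasureSet.prodMk ?_ (IsTightMeasureSet.prodMk ?_ ?_))
  · refine htight.subset ?_
    rintro _ ⟨_, ⟨k, rfl⟩, rfl⟩
    exact ⟨k, by
      simp only [Measure.fst]
      rw [Measure.map_map measurable_fst (hZ k)]
      rfl⟩
  · refine isTightMeasureSet_pi fun i => ?_
    have hm : ∀ k, Measurable fun ω => (Z k ω).fabric i := fun k =>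
      (measurable_fabric i).comp (hZ k)
    have (k : ℕ) : IsProbabilityMeasure (P.map fun ω => (Z k ω).fabric i) :=
      Measure.isProbabilityMeasure_map (hm k).aemeasurable
    refine (hW.isTightMeasureSet_of_comparison
      (ν := fun k => P.map fun ω => (Z k ω).fabric i) hC hθ fun A hA hA0 => ?_).subset ?_
    · filter_upwards [hcomp i A hA hA0] with k hk
      rwa [Measure.map_apply (hm k) hA]
    · rintro _ ⟨_, ⟨_, ⟨_, ⟨k, rfl⟩, rfl⟩, rfl⟩, rfl⟩
      refine ⟨k, ?_⟩
      simp only [Measure.fst, Measure.snd]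
      rw [Measure.map_map measurable_snd (hZ k),
        Measure.map_map measurable_fst (measurable_snd.comp (hZ k)),
        Measure.map_map (measurable_pi_apply i)
          (measurable_fst.comp (measurable_snd.comp (hZ k)))]
      rfl
  · rw [isTightMeasureSet_iff_exists_isCompact_measure_compl_le]
    intro ε hε
    obtain ⟨l, hl⟩ := (hp0.eventually (eventually_le_nhds hε)).exists
    refine ⟨Set.Iio l, (Set.finite_Iio l).isCompact, ?_⟩
    rintro _ ⟨_, ⟨_, ⟨_, ⟨k, rfl⟩, rfl⟩, rfl⟩, rfl⟩
    refine le_trans (le_of_eq ?_) ((hp k l).trans hl)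
    simp only [Measure.fst, Measure.snd]
    rw [Measure.map_map measurable_snd (hZ k),
      Measure.map_map measurable_snd (measurable_snd.comp (hZ k)),
      Measure.map_map measurable_fst (measurable_snd.comp (measurable_snd.comp (hZ k))),
      Measure.map_apply (measurable_fst.comp (measurable_snd.comp (measurable_snd.comp (hZ k))))
        (measurableSet_Iio.compl)]
    congr 1
    ext ω
    simp
  · exact IsTightMeasureSet.of_compactSpace

/-- **Limits of random quilts.** Let random quilt codes `Z k` have paths converging in law. If the
code property fails with vanishing probability, the numbers of stitch points have a common tail
bound, and the fabrics eventually obey comparisons to the Brownian law, then there is a limit law on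
the set of quilt codes with the same bounds, the comparisons now holding for all events. -/
theorem IsBrownianLaw.exists_limit_code {hab : a < b} {W : Measure (PathSpace a b)}
    (hW : IsBrownianLaw hab W) {Ω : Type*} [MeasurableSpace Ω] {P : Measure Ω}
    [IsProbabilityMeasure P] {Z : ℕ → Ω → QuiltCode a b} (hZ : ∀ k, Measurable (Z k))
    (htight : IsTightMeasureSet (Set.range fun k => P.map fun ω => (Z k ω).path))
    {p : ℕ → ℝ≥0∞} (hp0 : Tendsto p atTop (𝓝 0)) (hp : ∀ k l, P {ω | l ≤ (Z k ω).num} ≤ p l)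
    {q : ℕ → ℝ≥0∞} (hq0 : Tendsto q atTop (𝓝 0))
    (hq : ∀ k, P {ω | ¬ IsQuiltCode hab (Z k ω)} ≤ q k)
    {C : ℝ≥0∞} (hC : C ≠ ∞) {θ : ℝ} (hθ : 0 < θ)
    (hcomp : ∀ i A, MeasurableSet A → W A ≠ 0 →
      ∀ᶠ k in atTop, P {ω | (Z k ω).fabric i ∈ A} ≤ C * W A ^ θ)
    {ν : ProbabilityMeasure (PathSpace a b)}
    (hlim : Tendsto (β := ProbabilityMeasure (PathSpace a b)) (fun k =>
      ⟨P.map fun ω => (Z k ω).path,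
        Measure.isProbabilityMeasure_map (measurable_path.comp (hZ k)).aemeasurable⟩)
      atTop (𝓝 ν)) :
    ∃ μ : Measure (QuiltCode a b), IsProbabilityMeasure μ ∧ μ.map QuiltCode.path = ν ∧
      (∀ᵐ z ∂μ, IsQuiltCode hab z) ∧ (∀ l, μ {z | l ≤ z.num} ≤ p l) ∧
      ∀ (C' : ℝ≥0∞) (θ' : ℝ), C' ≠ ∞ → 0 ≤ θ' →
        (∀ i A, MeasurableSet A → W A ≠ 0 →
          ∀ᶠ k in atTop, P {ω | (Z k ω).fabric i ∈ A} ≤ C' * W A ^ θ') →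
        ∀ i A, MeasurableSet A → μ {z | z.fabric i ∈ A} ≤ C' * W A ^ θ' := by
  have hprob (k : ℕ) : IsProbabilityMeasure (P.map (Z k)) :=
    Measure.isProbabilityMeasure_map (hZ k).aemeasurable
  let Q : ℕ → ProbabilityMeasure (QuiltCode a b) := fun k => ⟨P.map (Z k), hprob k⟩
  have hcpt : IsCompact (closure (Set.range Q)) := by
    refine isCompact_closure_of_isTightMeasureSet
      ((hW.isTightMeasureSet_code hZ htight hp0 hp hC hθ hcomp).subset ?_)
    rintro _ ⟨_, ⟨k, rfl⟩, rfl⟩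
    exact ⟨k, rfl⟩
  -- a limit along an ultrafilter is as good as one along a subsequence
  obtain ⟨μ, -, hμ⟩ := hcpt.ultrafilter_le_nhds ((hyperfilter ℕ).map Q) (by
    refine le_principal_iff.2 (Filter.mem_map.2 (Filter.Eventually.of_forall fun k => ?_))
    exact subset_closure ⟨k, rfl⟩)
  have hμ' : Tendsto Q (hyperfilter ℕ) (𝓝 μ) := hμ
  have hle : (hyperfilter ℕ : Filter ℕ) ≤ atTop := Nat.hyperfilter_le_atTop
  -- upper bounds for open sets pass to the limit
  have hopen : ∀ (U : Set (QuiltCode a b)), IsOpen U → ∀ (r : ℕ → ℝ≥0∞) (r' : ℝ≥0∞),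
      Tendsto r atTop (𝓝 r') → (∀ᶠ k in atTop, P {ω | Z k ω ∈ U} ≤ r k) →
      (μ : Measure (QuiltCode a b)) U ≤ r' := by
    intro U hU r r' hr hev
    refine (ProbabilityMeasure.le_liminf_measure_open_of_tendsto hμ' hU).trans ?_
    rw [← (hr.mono_left hle).liminf_eq]
    refine liminf_le_liminf ((hev.filter_mono hle).mono fun k hk => ?_)
    have : (Q k : Measure (QuiltCode a b)) U = P {ω | Z k ω ∈ U} :=
      Measure.map_apply (hZ k) hU.measurableSet
    rw [this]
    exact hk
  refine ⟨μ, inferInstance, ?_, ?_, ?_, ?_⟩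
  · have h1 := ((ProbabilityMeasure.continuous_map
      (f := (QuiltCode.path : QuiltCode a b → _)) continuous_fst).tendsto μ).comp hμ'
    have h2 := tendsto_nhds_unique h1 ((hlim.mono_left hle).congr fun k => ?_)
    · rw [← h2]; rfl
    · apply Subtype.ext
      exact (Measure.map_map measurable_path (hZ k)).symm
  · rw [ae_iff]
    refine le_antisymm (hopen _ (isClosed_isQuiltCode hab).isOpen_compl q 0 hq0 ?_) bot_le
    exact Filter.Eventually.of_forall hq
  · intro l
    exact hopen _ ((isOpen_discrete (Set.Ici l)).preimage continuous_num) (fun _ => p l) _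
      tendsto_const_nhds (Filter.Eventually.of_forall fun k => hp k l)
  · intro C' θ' hC' hθ' hcomp' i A hA
    have hm (k : ℕ) : Measurable fun ω => (Z k ω).fabric i := (measurable_fabric i).comp (hZ k)
    have := hW.comparison_of_limit (ν := fun k => P.map fun ω => (Z k ω).fabric i)
      (ν' := (μ : Measure (QuiltCode a b)).map fun z => z.fabric i) hC' hθ'
      (fun A hA hA0 => ?_) (fun U hU r hr => ?_) A
    · rwa [Measure.map_apply (measurable_fabric i) hA] at this
    · filter_upwards [hcomp' i A hA hA0] with k hk
      rwa [Measure.map_apply (hm k) hA]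
    · rw [Measure.map_apply (measurable_fabric i) hU.measurableSet]
      refine hopen _ (hU.preimage (continuous_fabric i)) (fun _ => r) r tendsto_const_nhds ?_
      filter_upwards [hr] with k hk
      rwa [Measure.map_apply (hm k) hU.measurableSet] at hk

open scoped unitInterval

/-! ### Nondegenerate patches -/

/-- The indices of the patches of positive length. -/
noncomputable def activeSet (z : QuiltCode a b) : Finset ℕ :=
  {k ∈ Finset.range (z.num + 1) | z.pos k < z.pos (k + 1)}

/-- The index of the `l`-th patch of positive length, counted from `0` (and `0` if there is no such
patch). -/
noncomputable def label (z : QuiltCode a b) (l : ℕ) : ℕ := Nat.nth (· ∈ activeSet z) l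

lemma mem_activeSet {z : QuiltCode a b} {k : ℕ} :
    k ∈ activeSet z ↔ k ≤ z.num ∧ z.pos k < z.pos (k + 1) := by
  simp [activeSet]

lemma finite_activeSet (z : QuiltCode a b) : (Set.ofPred (· ∈ activeSet z)).Finite :=
  (activeSet z).finite_toSet

lemma card_toFinset_activeSet (z : QuiltCode a b) :
    (finite_activeSet z).toFinset.card = (activeSet z).card := by
  congr 1
  ext k
  simp

lemma label_mem {z : QuiltCode a b} {l : ℕ} (hl : l < (activeSet z).card) :
    label z l ∈ activeSet z :=
  Nat.nth_mem_of_lt_card (finite_activeSet z) (by rwa [card_toFinset_activeSet])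

lemma label_lt_label {z : QuiltCode a b} {l m : ℕ} (hlm : l < m) (hm : m < (activeSet z).card) :
    label z l < label z m :=
  Nat.nth_lt_nth_of_lt_card (finite_activeSet z) hlm (by rwa [card_toFinset_activeSet])

lemma exists_label_eq {z : QuiltCode a b} {k : ℕ} (hk : k ∈ activeSet z) :
    ∃ l < (activeSet z).card, label z l = k := by
  obtain ⟨l, hl, h⟩ := Nat.exists_lt_card_finite_nth_eq (p := (· ∈ activeSet z))
    (finite_activeSet z) hk
  exact ⟨l, by rwa [card_toFinset_activeSet] at hl, h⟩

lemma count_label {z : QuiltCode a b} {l : ℕ} (hl : l < (activeSet z).card) :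
    Nat.count (· ∈ activeSet z) (label z l) = l :=
  Nat.count_nth_of_lt_card_finite (finite_activeSet z) (by rwa [card_toFinset_activeSet])

lemma card_activeSet_le (z : QuiltCode a b) : (activeSet z).card ≤ z.num + 1 :=
  (Finset.card_filter_le _ _).trans_eq (Finset.card_range _)

namespace IsQuiltCode

variable {hab : a < b} {z : QuiltCode a b}

lemma pos_mono (hz : IsQuiltCode hab z) : Monotone z.pos := monotone_nat_of_le_succ hz.2.2.1

lemma pos_last (hz : IsQuiltCode hab z) : z.pos (z.num + 1) = rightPt hab := hz.2.2.2.1 _ rfl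

/-- On each patch the path of a quilt code is a vertical shift of the fabric. -/
lemma path_eq (hz : IsQuiltCode hab z) {i : ℕ} (hi : i ≤ z.num) {x : Set.Icc a b}
    (h1 : z.pos i ≤ x) (h2 : x ≤ z.pos (i + 1)) :
    z.path x = z.fabric i x + (z.path (z.pos i) - z.fabric i (z.pos i)) := by
  have := hz.2.2.2.2 i x hi
  rw [min_eq_left h2, max_eq_right h1] at this
  linarith

/-- Nodes agree if there is no patch of positive length between them. -/
lemma pos_eq_of_forall_notMem (hz : IsQuiltCode hab z) {m n : ℕ} (hmn : m ≤ n)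
    (hn : n ≤ z.num + 1) (h : ∀ k, m ≤ k → k < n → k ∉ activeSet z) : z.pos m = z.pos n := by
  induction n, hmn using Nat.le_induction with
  | base => rfl
  | succ n hmn ih =>
    rw [ih (by omega) fun k h1 h2 => h k h1 (by omega)]
    have := h n hmn (by omega)
    rw [mem_activeSet, not_and] at this
    exact le_antisymm (hz.2.2.1 n) (not_lt.1 (this (by omega)))

lemma card_activeSet_pos (hz : IsQuiltCode hab z) : 0 < (activeSet z).card := by
  rw [Finset.card_pos, Finset.nonempty_iff_ne_empty]
  intro h
  have := hz.pos_eq_of_forall_notMem (Nat.zero_le _) le_rfl (by simp [h])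
  rw [hz.2.1, hz.pos_last] at this
  exact hab.ne (Subtype.ext_iff.1 this)

lemma pos_label_zero (hz : IsQuiltCode hab z) : z.pos (label z 0) = leftPt hab := by
  have h0 := label_mem hz.card_activeSet_pos
  rw [← hz.2.1]
  refine (hz.pos_eq_of_forall_notMem (Nat.zero_le _) ((mem_activeSet.1 h0).1.trans (by omega))
    fun k _ hk hmem => ?_).symm
  obtain ⟨l, hl, rfl⟩ := exists_label_eq hmem
  rcases Nat.eq_zero_or_pos l with rfl | hl0
  · exact lt_irrefl _ hk
  · exact absurd hk (label_lt_label hl0 hl).not_gt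

lemma pos_label_succ (hz : IsQuiltCode hab z) {l : ℕ} (hl : l + 1 < (activeSet z).card) :
    z.pos (label z l + 1) = z.pos (label z (l + 1)) := by
  have h1 := label_mem hl
  refine hz.pos_eq_of_forall_notMem (label_lt_label (Nat.lt_succ_self l) hl)
    ((mem_activeSet.1 h1).1.trans (by omega)) fun k hk1 hk2 hmem => ?_
  obtain ⟨m, hm, rfl⟩ := exists_label_eq hmem
  rcases lt_or_ge l m with h | h
  · rcases (show l + 1 ≤ m from h).eq_or_lt with h' | h'
    · rw [h'] at hk2
      exact lt_irrefl _ hk2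
    · exact absurd hk2 (label_lt_label h' hm).not_gt
  · rcases h.eq_or_lt with rfl | h'
    · omega
    · have := label_lt_label h' (show l < (activeSet z).card by omega)
      omega

lemma pos_label_last (hz : IsQuiltCode hab z) {l : ℕ} (hl : l + 1 = (activeSet z).card) :
    z.pos (label z l + 1) = rightPt hab := by
  rw [← hz.pos_last]
  have h1 := label_mem (show l < (activeSet z).card by omega)
  refine hz.pos_eq_of_forall_notMem (Nat.succ_le_succ (mem_activeSet.1 h1).1) le_rfl
    fun k hk1 hk2 hmem => ?_
  obtain ⟨m, hm, rfl⟩ := exists_label_eq hmem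
  rcases (show m ≤ l by omega).eq_or_lt with rfl | h'
  · omega
  · have := label_lt_label h' (show l < (activeSet z).card by omega)
    omega

end IsQuiltCode

/-! ### Quilts with distinct stitch points -/

lemma sort_image_range {T : ℕ → ℝ} {M : ℕ} (hT : StrictMonoOn T (Set.Iio M)) :
    ((Finset.range M).image T).sort (· ≤ ·) = (List.range M).map T := by
  have hpw : ((List.range M).map T).Pairwise (· < ·) := by
    rw [List.pairwise_map]
    refine List.Pairwise.imp_of_mem ?_ List.pairwise_lt_range
    intro i j hi hj hij
    exact hT (by simpa using hi) (by simpa using hj) hij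
  have h1 : ((List.range M).map T).toFinset = (Finset.range M).image T := by
    ext x; simp
  rw [← h1]
  exact (List.toFinset_sort (· ≤ ·) (hpw.imp ne_of_lt)).2 (hpw.imp le_of_lt)

lemma card_image_range {T : ℕ → ℝ} {M : ℕ} (hT : StrictMonoOn T (Set.Iio M)) :
    ((Finset.range M).image T).card = M := by
  rw [Finset.card_image_of_injOn, Finset.card_range]
  simpa using hT.injOn

lemma node_image_range {T : ℕ → ℝ} {M : ℕ} (hT : StrictMonoOn T (Set.Iio M)) (i : ℕ) :
    node a b ((Finset.range M).image T) (i + 1) = if i < M then T i else b := by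
  rw [node, sort_image_range hT]
  split_ifs with h
  · rw [List.getD_eq_getElem _ _ (by simpa using h)]
    simp
  · rw [List.getD_eq_default _ _ (by simpa using h)]

/-- The quantities that the repair of a quilt code depends on: the code, a point of `[0,1]` that
determines the number of auxiliary patches, and the path that continues the auxiliary fabrics. -/
abbrev RepairSample (a b : ℝ) : Type := QuiltCode a b × I × PathSpace a b

/-- The number of auxiliary patches at `a`; it is uniform on `0, …, N` if the point of `[0,1]` is
uniform. -/
noncomputable def shift (ω : RepairSample a b) : ℕ := ⌊((ω.1.num : ℝ) + 1) * ω.2.1⌋₊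

/-- A number that encodes the index of the first patch of positive length together with a lower
bound for its length. -/
noncomputable def germClass (z : QuiltCode a b) : ℕ :=
  Nat.pair (label z 0) ⌈((z.pos (label z 0 + 1) : ℝ) - a)⁻¹⌉₊

/-- The lower bound for the length of the first patch of positive length that a value of
`germClass` provides. -/
noncomputable def germBound (c : ℕ) : ℝ := ((Nat.unpair c).2 + 1 : ℝ)⁻¹

lemma germBound_pos (c : ℕ) : 0 < germBound c := by unfold germBound; positivity

/-- The auxiliary fabric: it follows the first fabric that matters up to the time `d c`, with `c`
the germ class, and continues with the increments of an independent path. -/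
noncomputable def filler (d : ℕ → Set.Icc a b) (ω : RepairSample a b) : PathSpace a b :=
  splice (d (germClass ω.1)) (ω.1.fabric (label ω.1 0)) ω.2.2

/-- The fabrics of the repaired quilt, vanishing at `a`: the fabrics of the patches of positive
length occupy the places from `shift ω` on, and all other places have the auxiliary fabric. -/
noncomputable def repairedFabric (d : ℕ → Set.Icc a b) (i : ℕ) (ω : RepairSample a b) :
    PathSpace a b :=
  if shift ω ≤ i ∧ i < shift ω + (activeSet ω.1).card then ω.1.fabric (label ω.1 (i - shift ω))
  else filler d ω

/-- The stitch points of the repaired quilt: first `shift ω` equidistant points that end at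
the time `d c`, with `c` the germ class, then the nodes between patches of positive length. -/
noncomputable def stitch (d : ℕ → Set.Icc a b) (j : ℕ) (ω : RepairSample a b) : ℝ :=
  if j < shift ω then
    a + ((d (germClass ω.1) : ℝ) - a) * ((j + 1) / shift ω)
  else ω.1.pos (label ω.1 (j - shift ω + 1))

/-- The number of stitch points of the repaired quilt. -/
noncomputable def numStitch (ω : RepairSample a b) : ℕ := shift ω + ((activeSet ω.1).card - 1)

/-- The set of stitch points of the repaired quilt. -/
noncomputable def stitchSet (d : ℕ → Set.Icc a b) (ω : RepairSample a b) : Finset ℝ :=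
  (Finset.range (numStitch ω)).image fun j => stitch d j ω

lemma stitch_mem_Icc (d : ℕ → Set.Icc a b) (j : ℕ) (ω : RepairSample a b) :
    stitch d j ω ∈ Set.Icc a b := by
  unfold stitch
  split_ifs with h
  · have h1 := (d (germClass ω.1)).2
    have h2 : ((j : ℝ) + 1) / shift ω ≤ 1 := by
      rw [div_le_one (by exact_mod_cast (by omega : 0 < shift ω))]
      exact_mod_cast h
    have h3 : 0 ≤ ((j : ℝ) + 1) / shift ω := by positivity
    constructor
    · nlinarith [h1.1]
    · nlinarith [h1.1, h1.2]
  · exact Subtype.coe_prop _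

/-- The germ time precedes the end of the first patch of positive length. -/
lemma IsQuiltCode.germTime_lt {hab : a < b} {z : QuiltCode a b} (hz : IsQuiltCode hab z)
    {d : ℕ → Set.Icc a b} (hd : ∀ c, (d c : ℝ) < a + germBound c) :
    d (germClass z) < z.pos (label z 0 + 1) := by
  have h0 : (0 : ℝ) < (z.pos (label z 0 + 1) : ℝ) - a := by
    have := (mem_activeSet.1 (label_mem hz.card_activeSet_pos)).2
    rw [hz.pos_label_zero, ← Subtype.coe_lt_coe] at this
    exact sub_pos.2 this
  have h1 := hd (germClass z)
  have h2 : germBound (germClass z) ≤ (z.pos (label z 0 + 1) : ℝ) - a := by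
    rw [germBound, germClass, Nat.unpair_pair]
    refine inv_le_of_inv_le₀ h0 ((Nat.le_ceil _).trans ?_)
    simp
  rw [← Subtype.coe_lt_coe]
  linarith

lemma IsQuiltCode.strictMonoOn_stitch {hab : a < b} {ω : RepairSample a b}
    (hz : IsQuiltCode hab ω.1) {d : ℕ → Set.Icc a b} (hda : ∀ c, a < d c)
    (hd : ∀ c, (d c : ℝ) < a + germBound c) :
    StrictMonoOn (fun j => stitch d j ω) (Set.Iio (numStitch ω)) := by
  have hlt := Subtype.coe_lt_coe.2 (hz.germTime_lt hd)
  have hc := hda (germClass ω.1)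
  intro i hi j hj hij
  simp only [Set.mem_Iio, numStitch] at hi hj
  simp only [stitch]
  rcases lt_or_ge j (shift ω) with hj' | hj'
  · rw [if_pos hj', if_pos (hij.trans hj')]
    have h0 : (0 : ℝ) < shift ω := by exact_mod_cast (by omega : 0 < shift ω)
    have : ((i : ℝ) + 1) / shift ω < (j + 1) / shift ω := by
      gcongr
    nlinarith
  · rw [if_neg (not_lt.2 hj')]
    have hmem := label_mem (z := ω.1) (l := j - shift ω + 1) (by omega)
    have h1 : ω.1.pos (label ω.1 (j - shift ω) + 1) ≤ ω.1.pos (label ω.1 (j - shift ω + 1)) :=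
      hz.pos_mono (label_lt_label (Nat.lt_succ_self _) (by omega))
    split_ifs with hi'
    · have h0 : (0 : ℝ) < shift ω := by exact_mod_cast (by omega : 0 < shift ω)
      have h2 : ((i : ℝ) + 1) / shift ω ≤ 1 := by
        rw [div_le_one h0]
        exact_mod_cast hi'
      have h3 : ω.1.pos (label ω.1 0 + 1) ≤ ω.1.pos (label ω.1 (j - shift ω + 1)) :=
        hz.pos_mono (label_lt_label (Nat.succ_pos _) (by omega))
      have h4 := Subtype.coe_le_coe.2 h3
      nlinarith
    · have h2 := (mem_activeSet.1 (label_mem (z := ω.1) (l := i - shift ω + 1) (by omega))).2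
      have h3 : ω.1.pos (label ω.1 (i - shift ω + 1) + 1) ≤
          ω.1.pos (label ω.1 (j - shift ω + 1)) :=
        hz.pos_mono (label_lt_label (by omega) (by omega))
      exact Subtype.coe_lt_coe.2 (h2.trans_le h3)

/-- **Repair of a quilt.** The path of a quilt code is the quilt with the repaired fabrics and
stitch points. -/
theorem IsQuiltCode.isQuilt_repaired {hab : a < b} {ω : RepairSample a b}
    (hz : IsQuiltCode hab ω.1) {d : ℕ → Set.Icc a b} (hda : ∀ c, a < d c)
    (hd : ∀ c, (d c : ℝ) < a + germBound c) :
    IsQuilt (fun i => repairedFabric d i ω +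
        ContinuousMap.const _ (if i = 0 then ω.1.path (leftPt hab) else 0))
      (stitchSet d ω) ω.1.path := by
  have hT := hz.strictMonoOn_stitch hda hd
  have hcard := hz.card_activeSet_pos
  have hlt := hz.germTime_lt hd
  set y := shift ω with hy
  set z := ω.1 with hzdef
  have hnum : numStitch ω = y + ((activeSet z).card - 1) := rfl
  have hleft : ∀ k, z.fabric k (leftPt hab) = 0 := hz.1
  refine ⟨fun i => if i = 0 then 0 else if i < y then z.path (leftPt hab) else
    z.path (z.pos (label z (i - y))) - z.fabric (label z (i - y)) (z.pos (label z (i - y))),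
    rfl, fun i hi x hx1 hx2 => ?_⟩
  rw [stitchSet, card_image_range hT] at hi
  rw [stitchSet, node_image_range hT] at hx2
  have hiM : i ≤ y + ((activeSet z).card - 1) := hi
  rcases lt_or_ge i y with hiy | hiy
  · -- an auxiliary patch, contained in `[a, d c]`
    have hxd : x ≤ d (germClass z) := by
      rw [if_pos (by omega), stitch, if_pos hiy] at hx2
      have h0 : (0 : ℝ) < y := by exact_mod_cast (by omega : 0 < y)
      have h2 : ((i : ℝ) + 1) / y ≤ 1 := by
        rw [div_le_one h0]
        exact_mod_cast hiy
      have hc := hda (germClass z)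
      rw [← Subtype.coe_le_coe]
      refine hx2.trans ?_
      nlinarith
    have hpath := hz.path_eq (i := label z 0) (x := x) (mem_activeSet.1 (label_mem hcard)).1
      (by rw [hz.pos_label_zero]; exact leftPt_le hab x) (hxd.trans hlt.le)
    rw [hz.pos_label_zero, hleft, sub_zero] at hpath
    have hF : repairedFabric d i ω x = z.fabric (label z 0) x := by
      rw [repairedFabric, if_neg (by omega), filler, splice_apply_of_le hxd]
    simp only [ContinuousMap.add_apply, ContinuousMap.const_apply, hF, hpath]
    split_ifs <;> simp
  · -- a patch of the given quilt, possibly without an initial piece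
    set l := i - y with hl
    have hlc : l < (activeSet z).card := by omega
    have h1 : z.pos (label z l) ≤ x := by
      rw [← Subtype.coe_le_coe]
      rcases Nat.eq_zero_or_pos l with h0 | h0
      · rw [h0, hz.pos_label_zero]
        exact x.2.1
      · obtain ⟨i', rfl⟩ : ∃ i', i = i' + 1 := ⟨i - 1, by omega⟩
        rw [stitchSet, node_image_range hT, if_pos (by omega), stitch,
          if_neg (by omega)] at hx1
        have : i' - shift ω + 1 = l := by omega
        rwa [this] at hx1
    have h2 : x ≤ z.pos (label z l + 1) := by
      rw [← Subtype.coe_le_coe]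
      split_ifs at hx2 with h
      · rw [hnum] at h
        rw [stitch, if_neg (by omega)] at hx2
        rwa [hz.pos_label_succ (by omega)]
      · rw [hnum] at h
        rw [hz.pos_label_last (by omega)]
        exact hx2
    have hpath := hz.path_eq (mem_activeSet.1 (label_mem hlc)).1 h1 h2
    have hF : repairedFabric d i ω x = z.fabric (label z l) x := by
      rw [repairedFabric, if_pos ⟨hiy, show i < y + (activeSet z).card by omega⟩]
    simp only [ContinuousMap.add_apply, ContinuousMap.const_apply, hF]
    rw [hpath]
    rcases Nat.eq_zero_or_pos i with h0 | h0
    · have hl0 : l = 0 := by omega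
      rw [if_pos h0, if_pos h0, hl0, hz.pos_label_zero, hleft]
      ring
    · rw [if_neg h0.ne', if_neg h0.ne', if_neg (by omega)]
      ring

lemma IsQuiltCode.repairedFabric_mem_pinned {hab : a < b} {ω : RepairSample a b}
    (hz : IsQuiltCode hab ω.1) (d : ℕ → Set.Icc a b) (i : ℕ) :
    repairedFabric d i ω ∈ pinned hab := by
  unfold repairedFabric
  split_ifs
  · exact hz.1 _
  · exact splice_mem_pinned _ (hz.1 _)

/-! ### Measurability of the repaired quilt -/

lemma measurable_comp_countable {Ω E ι : Type*} [MeasurableSpace Ω] [MeasurableSpace E]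
    [MeasurableSpace ι] [Countable ι] [MeasurableSingletonClass ι] {F : ι → Ω → E}
    (hF : ∀ n, Measurable (F n)) {h : Ω → ι} (hh : Measurable h) :
    Measurable fun ω => F (h ω) ω := by
  have : Measurable fun p : ι × Ω => F p.1 p.2 := measurable_from_prod_countable_right hF
  exact this.comp (hh.prodMk measurable_id)

lemma measurableSet_mem_activeSet (k : ℕ) :
    MeasurableSet {z : QuiltCode a b | k ∈ activeSet z} := by
  simp only [mem_activeSet]
  exact (measurableSet_le measurable_const measurable_num).inter
    (measurableSet_lt (measurable_subtype_coe.comp (measurable_pos k))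
      (measurable_subtype_coe.comp (measurable_pos (k + 1))))

lemma measurable_comp_activeSet {E : Type*} [MeasurableSpace E] (h : Finset ℕ → E) :
    Measurable fun z : QuiltCode a b => h (activeSet z) := by
  intro s _
  have : (fun z : QuiltCode a b => h (activeSet z)) ⁻¹' s =
      ⋃ D ∈ h ⁻¹' s, ⋂ k, {z : QuiltCode a b | k ∈ activeSet z ↔ k ∈ D} := by
    ext z
    simp only [Set.mem_preimage, Set.mem_iUnion, Set.mem_iInter, Set.mem_ofPred_eq, exists_prop]
    constructor
    · exact fun hz => ⟨activeSet z, hz, fun k => Iff.rfl⟩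
    · rintro ⟨D, hD, hz⟩
      rwa [Finset.ext hz]
  rw [this]
  refine MeasurableSet.biUnion (Set.to_countable _) fun D _ => MeasurableSet.iInter fun k => ?_
  by_cases hk : k ∈ D
  · simp only [hk, iff_true]
    exact measurableSet_mem_activeSet k
  · simp only [hk, iff_false]
    exact (measurableSet_mem_activeSet k).compl

lemma measurable_label (l : ℕ) : Measurable fun z : QuiltCode a b => label z l :=
  measurable_comp_activeSet fun D => Nat.nth (· ∈ D) l

lemma measurable_card_activeSet : Measurable fun z : QuiltCode a b => (activeSet z).card :=
  measurable_comp_activeSet Finset.card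

lemma measurable_germClass : Measurable (germClass : QuiltCode a b → ℕ) := by
  have h1 : Measurable fun z : QuiltCode a b => z.pos (label z 0 + 1) :=
    measurable_comp_countable (F := fun k (z : QuiltCode a b) => z.pos (k + 1))
      (fun k => measurable_pos (k + 1)) (measurable_label 0)
  have h2 : Measurable fun z : QuiltCode a b => ⌈((z.pos (label z 0 + 1) : ℝ) - a)⁻¹⌉₊ :=
    Nat.measurable_ceil.comp ((measurable_subtype_coe.comp h1).sub_const a).inv
  exact (measurable_of_countable fun p : ℕ × ℕ => Nat.pair p.1 p.2).comp
    ((measurable_label 0).prodMk h2)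

lemma measurable_shift : Measurable (shift : RepairSample a b → ℕ) :=
  Nat.measurable_floor.comp
    (((measurable_from_top (f := fun n : ℕ => (n : ℝ) + 1)).comp
      (measurable_num.comp measurable_fst)).mul
      (measurable_subtype_coe.comp (measurable_fst.comp measurable_snd)))

lemma measurable_filler (d : ℕ → Set.Icc a b) :
    Measurable (filler d : RepairSample a b → PathSpace a b) := by
  have h1 : Measurable fun z : QuiltCode a b => z.fabric (label z 0) :=
    measurable_comp_countable (F := fun k (z : QuiltCode a b) => z.fabric k)
      measurable_fabric (measurable_label 0)
  exact measurable_comp_countable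
    (F := fun c (ω : RepairSample a b) => splice (d c) (ω.1.fabric (label ω.1 0)) ω.2.2)
    (fun c => (measurable_splice (d c)).comp
      ((h1.comp measurable_fst).prodMk (measurable_snd.comp measurable_snd)))
    (measurable_germClass.comp measurable_fst)

lemma measurableSet_main (i : ℕ) : MeasurableSet
    {ω : RepairSample a b | shift ω ≤ i ∧ i < shift ω + (activeSet ω.1).card} :=
  (measurableSet_le measurable_shift measurable_const).inter
    (measurableSet_lt measurable_const
      (measurable_shift.add (measurable_card_activeSet.comp measurable_fst)))

lemma measurable_repairedFabric (d : ℕ → Set.Icc a b) (i : ℕ) :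
    Measurable (repairedFabric d i : RepairSample a b → PathSpace a b) := by
  have h1 (l : ℕ) : Measurable fun z : QuiltCode a b => z.fabric (label z l) :=
    measurable_comp_countable (F := fun k (z : QuiltCode a b) => z.fabric k)
      measurable_fabric (measurable_label l)
  exact Measurable.ite (measurableSet_main i)
    (measurable_comp_countable
      (F := fun y (ω : RepairSample a b) => ω.1.fabric (label ω.1 (i - y)))
      (fun y => (h1 (i - y)).comp measurable_fst) measurable_shift)
    (measurable_filler d)

lemma measurable_stitch (d : ℕ → Set.Icc a b) (j : ℕ) :
    Measurable (stitch d j : RepairSample a b → ℝ) := by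
  have h1 (l : ℕ) : Measurable fun z : QuiltCode a b => (z.pos (label z l) : ℝ) :=
    measurable_subtype_coe.comp (measurable_comp_countable
      (F := fun k (z : QuiltCode a b) => z.pos k) measurable_pos (measurable_label l))
  refine Measurable.ite (measurableSet_lt measurable_const measurable_shift) ?_
    (measurable_comp_countable
      (F := fun y (ω : RepairSample a b) => (ω.1.pos (label ω.1 (j - y + 1)) : ℝ))
      (fun y => (h1 (j - y + 1)).comp measurable_fst) measurable_shift)
  exact (((measurable_from_top (f := fun c : ℕ => (d c : ℝ) - a)).comp
    (measurable_germClass.comp measurable_fst)).mul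
    ((measurable_from_top (f := fun y : ℕ => ((j : ℝ) + 1) / y)).comp measurable_shift)).const_add a

lemma measurable_numStitch : Measurable (numStitch : RepairSample a b → ℕ) :=
  measurable_shift.add ((measurable_from_top (f := fun n : ℕ => n - 1)).comp
    (measurable_card_activeSet.comp measurable_fst))

/-- The set of finitely many random points is a random finite set. -/
lemma isRandomFiniteSubset_image {Ω : Type*} [MeasurableSpace Ω] {T : ℕ → Ω → ℝ}
    (hT : ∀ j, Measurable (T j)) (hmem : ∀ j ω, T j ω ∈ Set.Icc a b) {M : Ω → ℕ}
    (hM : Measurable M) :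
    IsRandomFiniteSubset a b fun ω => (Finset.range (M ω)).image fun j => T j ω := by
  classical
  refine ⟨fun ω x hx => ?_, fun U hU => ?_⟩
  · simp only [Finset.coe_image, Set.mem_image] at hx
    obtain ⟨j, -, rfl⟩ := hx
    exact hmem j ω
  · refine measurable_comp_countable
      (F := fun m ω => (((Finset.range m).image fun j => T j ω : Finset ℝ) ∩ U : Set ℝ).ncard)
      (fun m => ?_) hM
    induction m with
    | zero => simp
    | succ m ih =>
      -- the last point counts if it lies in `U` and differs from the earlier ones
      have hset : MeasurableSet {ω | T m ω ∈ U ∧ ∀ j < m, T j ω ≠ T m ω} := by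
        have : {ω | T m ω ∈ U ∧ ∀ j < m, T j ω ≠ T m ω} =
            T m ⁻¹' U ∩ ⋂ j, ⋂ (_ : j < m), {ω | T j ω = T m ω}ᶜ := by
          ext ω
          simp
        rw [this]
        exact (hT m hU).inter <| MeasurableSet.iInter fun j => MeasurableSet.iInter fun _ =>
          (measurableSet_eq_fun (hT j) (hT m)).compl
      have : (fun ω => (((Finset.range (m + 1)).image fun j => T j ω : Finset ℝ) ∩ U :
          Set ℝ).ncard) = fun ω => (((Finset.range m).image fun j => T j ω : Finset ℝ) ∩ U :
          Set ℝ).ncard + if T m ω ∈ U ∧ ∀ j < m, T j ω ≠ T m ω then 1 else 0 := by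
        funext ω
        rw [Finset.range_add_one, Finset.image_insert, Finset.coe_insert]
        set A : Finset ℝ := (Finset.range m).image fun j => T j ω with hA
        have hfin : ((A : Set ℝ) ∩ U).Finite := A.finite_toSet.inter_of_left U
        have hmemA : T m ω ∈ A ↔ ∃ j < m, T j ω = T m ω := by simp [hA]
        by_cases hU' : T m ω ∈ U
        · rw [Set.insert_inter_of_mem hU']
          by_cases hA' : T m ω ∈ A
          · rw [Set.insert_eq_of_mem (show T m ω ∈ (A : Set ℝ) ∩ U from ⟨hA', hU'⟩), if_neg]
            · rfl
            · rintro ⟨-, h⟩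
              obtain ⟨j, hj, hjm⟩ := hmemA.1 hA'
              exact h j hj hjm
          · rw [Set.ncard_insert_of_notMem (fun h => hA' h.1) hfin, if_pos]
            exact ⟨hU', fun j hj hjm => hA' (hmemA.2 ⟨j, hj, hjm⟩)⟩
        · rw [Set.insert_inter_of_notMem hU', if_neg fun h => hU' h.1]
          rfl
      rw [this]
      exact ih.add (Measurable.ite hset measurable_const measurable_const)

lemma isRandomFiniteSubset_stitchSet (d : ℕ → Set.Icc a b) :
    IsRandomFiniteSubset a b (stitchSet d) :=
  isRandomFiniteSubset_image (measurable_stitch d) (stitch_mem_Icc d) measurable_numStitch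

/-! ### Comparison for the repaired fabrics -/

lemma min_le_rpow_mul_rpow (u v : ℝ≥0∞) {s : ℝ} (hs0 : 0 ≤ s) (hs1 : s ≤ 1) :
    min u v ≤ u ^ s * v ^ (1 - s) := by
  calc min u v = min u v ^ (s + (1 - s)) := by simp
    _ = min u v ^ s * min u v ^ (1 - s) := ENNReal.rpow_add_of_nonneg _ _ hs0 (by linarith)
    _ ≤ u ^ s * v ^ (1 - s) := by
      exact mul_le_mul' (ENNReal.rpow_le_rpow (min_le_left _ _) hs0)
        (ENNReal.rpow_le_rpow (min_le_right _ _) (by linarith))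

/-- The integer part of a uniform variable on `[0, n + 1]` takes each value with probability at
most `1 / (n + 1)`. -/
lemma volume_floor_mul_eq_le (n m : ℕ) :
    volume {u : I | ⌊((n : ℝ) + 1) * u⌋₊ = m} ≤ ((n : ℝ≥0∞) + 1)⁻¹ := by
  have hn : (0 : ℝ) < n + 1 := by positivity
  rw [unitInterval.volume_apply]
  calc volume (Subtype.val '' {u : I | ⌊((n : ℝ) + 1) * u⌋₊ = m})
      ≤ volume (Set.Icc ((m : ℝ) / (n + 1)) ((m + 1 : ℝ) / (n + 1))) := by
        refine measure_mono ?_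
        rintro _ ⟨u, hu, rfl⟩
        have hu' : ⌊((n : ℝ) + 1) * u⌋₊ = m := hu
        have h0 : 0 ≤ ((n : ℝ) + 1) * u := mul_nonneg hn.le u.2.1
        have h1 := Nat.floor_le h0
        have h2 := Nat.lt_floor_add_one (((n : ℝ) + 1) * u)
        rw [hu'] at h1 h2
        constructor
        · rw [div_le_iff₀ hn]; linarith
        · rw [le_div_iff₀ hn]; linarith
    _ = ((n : ℝ≥0∞) + 1)⁻¹ := by
        rw [Real.volume_Icc, ← sub_div, add_sub_cancel_left, one_div,
          ENNReal.ofReal_inv_of_pos hn, ENNReal.ofReal_add (by positivity) zero_le_one]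
        simp

/-- The law of the fabric of index `label z 0` on the event that the germ class is `c`. -/
noncomputable def germLaw (μ : Measure (QuiltCode a b)) (c : ℕ) : Measure (PathSpace a b) :=
  (μ.restrict {z | germClass z = c}).map fun z => z.fabric (label z 0)

lemma measurable_firstFabric : Measurable fun z : QuiltCode a b => z.fabric (label z 0) :=
  measurable_comp_countable (F := fun k (z : QuiltCode a b) => z.fabric k)
    measurable_fabric (measurable_label 0)

lemma measurableSet_germClass_eq (c : ℕ) :
    MeasurableSet {z : QuiltCode a b | germClass z = c} :=
  measurable_germClass (measurableSet_singleton c)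

lemma label_zero_of_germClass {z : QuiltCode a b} {c : ℕ} (h : germClass z = c) :
    label z 0 = (Nat.unpair c).1 := by
  rw [← h, germClass, Nat.unpair_pair]

lemma germLaw_le {μ : Measure (QuiltCode a b)} {C : ℝ≥0∞} {θ : ℝ} {W : Measure (PathSpace a b)}
    (hμ : ∀ i A, MeasurableSet A → μ {z | z.fabric i ∈ A} ≤ C * W A ^ θ) (c : ℕ)
    (A : Set (PathSpace a b)) (hA : MeasurableSet A) : germLaw μ c A ≤ C * W A ^ θ := by
  rw [germLaw, Measure.map_apply measurable_firstFabric hA,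
    Measure.restrict_apply (measurable_firstFabric hA)]
  refine (measure_mono ?_).trans (hμ (Nat.unpair c).1 A hA)
  rintro z ⟨h1, h2⟩
  rw [Set.mem_ofPred_eq, ← label_zero_of_germClass h2]
  exact h1

instance (μ : Measure (QuiltCode a b)) [IsFiniteMeasure μ] (c : ℕ) :
    IsFiniteMeasure (germLaw μ c) := by unfold germLaw; infer_instance

/-- The times up to which the auxiliary fabrics follow the given ones are chosen such that, on each
germ class, the auxiliary fabric is close to a Brownian path. -/
lemma IsBrownianLaw.exists_germTimes {hab : a < b} {W : Measure (PathSpace a b)}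
    (hW : IsBrownianLaw hab W) {μ : Measure (QuiltCode a b)} [IsFiniteMeasure μ]
    {C : ℝ≥0∞} {θ : ℝ} (hθ : 0 < θ)
    (hμ : ∀ i A, MeasurableSet A → μ {z | z.fabric i ∈ A} ≤ C * W A ^ θ) :
    ∃ d : ℕ → Set.Icc a b, (∀ c, a < d c) ∧ (∀ c, (d c : ℝ) < a + germBound c) ∧
      ∀ c A, MeasurableSet A → ((germLaw μ c).prod W) {p | splice (d c) p.1 p.2 ∈ A} ≤
        germLaw μ c Set.univ * W A + 2⁻¹ ^ c := by
  have hac : ∀ c, germLaw μ c ≪ W := fun c => Measure.AbsolutelyContinuous.mk fun A hA h0 => by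
    have := germLaw_le hμ c A hA
    rw [h0, ENNReal.zero_rpow_of_pos hθ, mul_zero] at this
    exact le_antisymm this bot_le
  choose d hd using fun c => hW.exists_prod_splice_le (hac c) (ε := 2⁻¹ ^ c) (by simp)
    (t := a + germBound c) (by linarith [germBound_pos c])
  exact ⟨d, fun c => (hd c).1, fun c => (hd c).2.1, fun c => (hd c).2.2⟩

/-- Comparison for the auxiliary fabric. -/
lemma IsBrownianLaw.prod_filler_le {hab : a < b} {W : Measure (PathSpace a b)}
    (hW : IsBrownianLaw hab W) {μ : Measure (QuiltCode a b)} [IsProbabilityMeasure μ]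
    {C : ℝ≥0∞} {θ : ℝ} (hθ : 0 < θ) (hθ1 : θ ≤ 1)
    (hμ : ∀ i A, MeasurableSet A → μ {z | z.fabric i ∈ A} ≤ C * W A ^ θ)
    {d : ℕ → Set.Icc a b}
    (hd : ∀ c A, MeasurableSet A → ((germLaw μ c).prod W) {p | splice (d c) p.1 p.2 ∈ A} ≤
      germLaw μ c Set.univ * W A + 2⁻¹ ^ c)
    {A : Set (PathSpace a b)} (hA : MeasurableSet A) :
    (μ.prod ((volume : Measure I).prod W)) {ω | filler d ω ∈ A} ≤
      W A + ∑' c : ℕ, min (2⁻¹ ^ c) (C * W A ^ θ) := by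
  have := hW.isProbabilityMeasure
  have hpiece : ∀ c, (μ.prod ((volume : Measure I).prod W))
      {ω | germClass ω.1 = c ∧ filler d ω ∈ A} =
      ((germLaw μ c).prod W) {p | splice (d c) p.1 p.2 ∈ A} := by
    intro c
    have h1 : MeasurableSet {p : QuiltCode a b × PathSpace a b |
        germClass p.1 = c ∧ splice (d c) (p.1.fabric (label p.1 0)) p.2 ∈ A} :=
      ((measurableSet_germClass_eq c).preimage measurable_fst).inter
        ((measurable_splice (d c)).comp ((measurable_firstFabric.comp measurable_fst).prodMk
          measurable_snd) hA)
    have h2 : Measurable fun ω : RepairSample a b => (ω.1, ω.2.2) :=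
      measurable_fst.prodMk (measurable_snd.comp measurable_snd)
    have h3 : (μ.prod ((volume : Measure I).prod W)).map (fun ω => (ω.1, ω.2.2)) = μ.prod W := by
      have := Measure.map_prod_map μ ((volume : Measure I).prod W) measurable_id measurable_snd
      rw [Measure.map_id, Measure.map_snd_prod, measure_univ, one_smul] at this
      exact this.symm
    have h4 : (germLaw μ c).prod W = ((μ.restrict {z | germClass z = c}).prod W).map
        (Prod.map (fun z => z.fabric (label z 0)) id) := by
      rw [← Measure.map_prod_map _ _ measurable_firstFabric measurable_id, Measure.map_id]
      rfl
    rw [h4, Measure.map_apply (measurable_firstFabric.prodMap measurable_id)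
      (measurableSet_splice (d c) hA)]
    have h5 : (μ.restrict {z | germClass z = c}).prod W =
        (μ.prod W).restrict ({z | germClass z = c} ×ˢ Set.univ) := by
      rw [← Measure.prod_restrict, Measure.restrict_univ]
    rw [h5, Measure.restrict_apply
      ((measurable_firstFabric.prodMap measurable_id) (measurableSet_splice (d c) hA)), ← h3,
      Measure.map_apply h2 (((measurable_firstFabric.prodMap measurable_id)
        (measurableSet_splice (d c) hA)).inter
          ((measurableSet_germClass_eq c).prod MeasurableSet.univ))]
    congr 1
    ext ω
    simp only [Set.mem_ofPred_eq, Set.mem_preimage, Set.mem_inter_iff, Set.mem_prod, Set.mem_univ,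
      and_true, Prod.map, id, filler]
    constructor
    · rintro ⟨h, h'⟩
      rw [h] at h'
      exact ⟨h', h⟩
    · rintro ⟨h', h⟩
      rw [h]
      exact ⟨rfl, h'⟩
  have hmass : ∑' c, germLaw μ c Set.univ = 1 := by
    have h1 : ∀ c, germLaw μ c Set.univ = μ {z | germClass z = c} := fun c => by
      rw [germLaw, Measure.map_apply measurable_firstFabric MeasurableSet.univ]
      simp
    simp_rw [h1]
    rw [← measure_iUnion (fun c c' hcc => ?_) measurableSet_germClass_eq]
    · rw [← measure_univ (μ := μ)]
      congr 1
      ext z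
      simp
    · exact Set.disjoint_left.2 fun z (h : germClass z = c) (h' : germClass z = c') =>
        hcc (h.symm.trans h')
  calc (μ.prod ((volume : Measure I).prod W)) {ω | filler d ω ∈ A}
      ≤ (μ.prod ((volume : Measure I).prod W))
        (⋃ c, {ω | germClass ω.1 = c ∧ filler d ω ∈ A}) := by
        refine measure_mono fun ω hω => ?_
        exact Set.mem_iUnion.2 ⟨germClass ω.1, rfl, hω⟩
    _ ≤ ∑' c, ((germLaw μ c).prod W) {p | splice (d c) p.1 p.2 ∈ A} := by
        refine (measure_iUnion_le _).trans_eq ?_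
        simp_rw [hpiece]
    _ ≤ ∑' c, (germLaw μ c Set.univ * W A + min (2⁻¹ ^ c) (C * W A ^ θ)) := by
        refine ENNReal.tsum_le_tsum fun c => ?_
        rw [← min_add_add_left]
        exact le_min (hd c A hA) ((hW.prod_splice_le (d c) hθ hθ1 (germLaw_le hμ c) hA).trans
          le_add_self)
    _ = W A + ∑' c : ℕ, min (2⁻¹ ^ c) (C * W A ^ θ) := by
        rw [ENNReal.tsum_add, ENNReal.tsum_mul_right, hmass, one_mul]

/-- Comparison for the fabrics that the random shift has put at place `i`. Given the code, each
fabric lands there with probability at most `1 / (N + 1)`, and the sum over the candidates is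
controlled by the tail of the number `N` of stitch points. -/
lemma prod_shifted_le {W : Measure (PathSpace a b)} [IsProbabilityMeasure W]
    {μ : Measure (QuiltCode a b)} [IsProbabilityMeasure μ] {C : ℝ≥0∞} {θ : ℝ}
    (hμ : ∀ i A, MeasurableSet A → μ {z | z.fabric i ∈ A} ≤ C * W A ^ θ)
    {p : ℕ → ℝ≥0∞} (hp : ∀ l, μ {z | l ≤ z.num} ≤ p l) (i : ℕ)
    {A : Set (PathSpace a b)} (hA : MeasurableSet A) :
    (μ.prod ((volume : Measure I).prod W))
        {ω | (shift ω ≤ i ∧ i < shift ω + (activeSet ω.1).card) ∧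
          ω.1.fabric (label ω.1 (i - shift ω)) ∈ A} ≤
      ∑' k : ℕ, ((k : ℝ≥0∞) + 1)⁻¹ * min (p k) (C * W A ^ θ) := by
  classical
  set r : QuiltCode a b → ℕ → ℕ := fun z k => Nat.count (· ∈ activeSet z) k with hr
  have hrm : ∀ k, Measurable fun z : QuiltCode a b => r z k := fun k =>
    measurable_comp_activeSet fun D => Nat.count (· ∈ D) k
  have hB : ∀ k, MeasurableSet {z : QuiltCode a b | k ≤ z.num ∧ z.fabric k ∈ A} := fun k =>
    (measurableSet_le measurable_const measurable_num).inter (measurable_fabric k hA)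
  have hpiece : ∀ k, (μ.prod ((volume : Measure I).prod W))
      {ω | (k ≤ ω.1.num ∧ ω.1.fabric k ∈ A) ∧ shift ω = i - r ω.1 k} ≤
      ((k : ℝ≥0∞) + 1)⁻¹ * min (p k) (C * W A ^ θ) := by
    intro k
    have hm : MeasurableSet {ω : RepairSample a b |
        (k ≤ ω.1.num ∧ ω.1.fabric k ∈ A) ∧ shift ω = i - r ω.1 k} :=
      ((hB k).preimage measurable_fst).inter (measurableSet_eq_fun measurable_shift
        ((measurable_from_top (f := fun n => i - n)).comp ((hrm k).comp measurable_fst)))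
    rw [Measure.prod_apply hm]
    calc ∫⁻ z, ((volume : Measure I).prod W) (Prod.mk z ⁻¹' {ω : RepairSample a b |
            (k ≤ ω.1.num ∧ ω.1.fabric k ∈ A) ∧ shift ω = i - r ω.1 k}) ∂μ
        ≤ ∫⁻ z, {z : QuiltCode a b | k ≤ z.num ∧ z.fabric k ∈ A}.indicator
            (fun _ => ((k : ℝ≥0∞) + 1)⁻¹) z ∂μ := by
          refine lintegral_mono fun z => ?_
          by_cases hz : k ≤ z.num ∧ z.fabric k ∈ A
          · rw [Set.indicator_of_mem (by exact hz)]
            calc _ ≤ ((volume : Measure I).prod W)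
                  ({u : I | ⌊((z.num : ℝ) + 1) * u⌋₊ = i - r z k} ×ˢ Set.univ) :=
                  measure_mono fun q hq => ⟨hq.2, Set.mem_univ _⟩
              _ ≤ ((z.num : ℝ≥0∞) + 1)⁻¹ := by
                  rw [Measure.prod_prod, measure_univ, mul_one]
                  exact volume_floor_mul_eq_le _ _
              _ ≤ ((k : ℝ≥0∞) + 1)⁻¹ := by
                  gcongr
                  exact hz.1
          · rw [Set.indicator_of_notMem (by exact hz)]
            refine le_of_eq (measure_mono_null (t := ∅) ?_ measure_empty)
            exact fun q hq => hz hq.1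
      _ = ((k : ℝ≥0∞) + 1)⁻¹ * μ {z | k ≤ z.num ∧ z.fabric k ∈ A} :=
          lintegral_indicator_const (hB k) _
      _ ≤ ((k : ℝ≥0∞) + 1)⁻¹ * min (p k) (C * W A ^ θ) := by
          gcongr
          exact le_min ((measure_mono fun z hz => hz.1).trans (hp k))
            ((measure_mono fun z hz => hz.2).trans (hμ k A hA))
  refine (measure_mono ?_).trans ((measure_iUnion_le _).trans (ENNReal.tsum_le_tsum hpiece))
  rintro ω ⟨⟨h1, h2⟩, h3⟩
  have hl : i - shift ω < (activeSet ω.1).card := by omega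
  refine Set.mem_iUnion.2 ⟨label ω.1 (i - shift ω), ⟨(mem_activeSet.1 (label_mem hl)).1, h3⟩, ?_⟩
  rw [hr]
  simp only
  rw [count_label hl]
  omega

/-- The constant in the comparison for the repaired fabrics. -/
noncomputable def repairConst (p : ℕ → ℝ≥0∞) (C : ℝ≥0∞) (s : ℝ) : ℝ≥0∞ :=
  1 + C ^ (1 - s) * (∑' c : ℕ, (2⁻¹ ^ c : ℝ≥0∞) ^ s + ∑' k : ℕ, ((k : ℝ≥0∞) + 1)⁻¹ * p k ^ s)

/-- **Comparison for the repaired fabrics.** The exponent deteriorates by an arbitrarily small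
factor, and the constant depends only on the given constant and tail bound. -/
theorem IsBrownianLaw.prod_repairedFabric_le {hab : a < b} {W : Measure (PathSpace a b)}
    (hW : IsBrownianLaw hab W) {μ : Measure (QuiltCode a b)} [IsProbabilityMeasure μ]
    {C : ℝ≥0∞} {θ : ℝ} (hθ : 0 < θ) (hθ1 : θ ≤ 1)
    (hμ : ∀ i A, MeasurableSet A → μ {z | z.fabric i ∈ A} ≤ C * W A ^ θ)
    {p : ℕ → ℝ≥0∞} (hp : ∀ l, μ {z | l ≤ z.num} ≤ p l) {d : ℕ → Set.Icc a b}
    (hd : ∀ c A, MeasurableSet A → ((germLaw μ c).prod W) {p | splice (d c) p.1 p.2 ∈ A} ≤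
      germLaw μ c Set.univ * W A + 2⁻¹ ^ c)
    {s : ℝ} (hs0 : 0 ≤ s) (hs1 : s ≤ 1) (i : ℕ)
    {A : Set (PathSpace a b)} (hA : MeasurableSet A) :
    (μ.prod ((volume : Measure I).prod W)) {ω | repairedFabric d i ω ∈ A} ≤
      repairConst p C s * W A ^ (θ * (1 - s)) := by
  have := hW.isProbabilityMeasure
  have hx : (C * W A ^ θ) ^ (1 - s) = C ^ (1 - s) * W A ^ (θ * (1 - s)) := by
    rw [ENNReal.mul_rpow_of_nonneg _ _ (by linarith), ENNReal.rpow_mul]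
  have hWA : W A ≤ W A ^ (θ * (1 - s)) := by
    nth_rewrite 1 [← ENNReal.rpow_one (W A)]
    exact ENNReal.rpow_le_rpow_of_exponent_ge prob_le_one (by nlinarith)
  calc (μ.prod ((volume : Measure I).prod W)) {ω | repairedFabric d i ω ∈ A}
      ≤ (μ.prod ((volume : Measure I).prod W)) ({ω | filler d ω ∈ A} ∪
          {ω | (shift ω ≤ i ∧ i < shift ω + (activeSet ω.1).card) ∧
            ω.1.fabric (label ω.1 (i - shift ω)) ∈ A}) := by
        refine measure_mono fun ω hω => ?_
        rw [Set.mem_ofPred_eq, repairedFabric] at hω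
        split_ifs at hω with h
        · exact Or.inr ⟨h, hω⟩
        · exact Or.inl hω
    _ ≤ (W A + ∑' c : ℕ, min (2⁻¹ ^ c) (C * W A ^ θ)) +
          ∑' k : ℕ, ((k : ℝ≥0∞) + 1)⁻¹ * min (p k) (C * W A ^ θ) :=
        (measure_union_le _ _).trans (add_le_add (hW.prod_filler_le hθ hθ1 hμ hd hA)
          (prod_shifted_le hμ hp i hA))
    _ ≤ (W A ^ (θ * (1 - s)) + ∑' c : ℕ, (2⁻¹ ^ c : ℝ≥0∞) ^ s * (C * W A ^ θ) ^ (1 - s)) +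
          ∑' k : ℕ, ((k : ℝ≥0∞) + 1)⁻¹ * (p k ^ s * (C * W A ^ θ) ^ (1 - s)) := by
        gcongr with c k
        · exact min_le_rpow_mul_rpow _ _ hs0 hs1
        · exact min_le_rpow_mul_rpow _ _ hs0 hs1
    _ = repairConst p C s * W A ^ (θ * (1 - s)) := by
        simp_rw [← mul_assoc]
        rw [ENNReal.tsum_mul_right, ENNReal.tsum_mul_right, hx, repairConst]
        ring

/-! ### Polynomially decaying tail bounds -/

/-- The sequence `p 1, p 2, …` with values in `[0,∞]`, and with the trivial bound `1` at `0`. -/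
noncomputable def tailBound (p : ℕ+ → ℝ) (l : ℕ) : ℝ≥0∞ :=
  if h : 0 < l then ENNReal.ofReal (p ⟨l, h⟩) else 1

lemma tailBound_coe (p : ℕ+ → ℝ) (l : ℕ+) : tailBound p l = ENNReal.ofReal (p l) := by
  rw [tailBound, dif_pos l.pos]
  rfl

namespace HasPolynomialDecay

variable {p : ℕ+ → ℝ} {β : ℝ}

lemma tailBound_le_one (hp : HasPolynomialDecay p β) (l : ℕ) : tailBound p l ≤ 1 := by
  unfold tailBound
  split_ifs
  · exact ENNReal.ofReal_le_one.2 (hp.1 _).2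
  · exact le_rfl

lemma tailBound_ne_top (hp : HasPolynomialDecay p β) (l : ℕ) : tailBound p l ≠ ∞ :=
  ne_top_of_le_ne_top ENNReal.one_ne_top (hp.tailBound_le_one l)

lemma eventually_tailBound_le (hp : HasPolynomialDecay p β) {ε : ℝ} (hε : 0 < ε) :
    ∀ᶠ l : ℕ in atTop, 0 < l ∧ tailBound p l ≤ ENNReal.ofReal ((l : ℝ) ^ (-β + ε)) := by
  obtain ⟨l₀, hl₀⟩ := eventually_atTop.1 (hp.2 ε hε)
  filter_upwards [eventually_ge_atTop (l₀ : ℕ)] with l hl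
  have hl0 : 0 < l := l₀.pos.trans_le hl
  refine ⟨hl0, ?_⟩
  rw [tailBound, dif_pos hl0]
  exact ENNReal.ofReal_le_ofReal (hl₀ ⟨l, hl0⟩ hl)

lemma tendsto_tailBound (hp : HasPolynomialDecay p β) (hβ : 0 < β) :
    Tendsto (tailBound p) atTop (𝓝 0) := by
  have h1 : Tendsto (fun l : ℕ => ENNReal.ofReal ((l : ℝ) ^ (-(β / 2)))) atTop (𝓝 0) := by
    have := ENNReal.tendsto_ofReal
      ((tendsto_rpow_neg_atTop (half_pos hβ)).comp tendsto_natCast_atTop_atTop)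
    simpa using this
  refine tendsto_of_tendsto_of_tendsto_of_le_of_le' tendsto_const_nhds h1
    (Eventually.of_forall fun _ => bot_le) ?_
  filter_upwards [hp.eventually_tailBound_le (half_pos hβ)] with l hl
  refine hl.2.trans_eq ?_
  congr 2
  ring

lemma tsum_tailBound_ne_top (hp : HasPolynomialDecay p β) (hβ : 0 < β) {s : ℝ} (hs : 0 < s) :
    ∑' k : ℕ, ((k : ℝ≥0∞) + 1)⁻¹ * tailBound p k ^ s ≠ ∞ := by
  obtain ⟨l₀, hl₀⟩ := eventually_atTop.1 (hp.eventually_tailBound_le (half_pos hβ))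
  have hsum : Summable fun k : ℕ => (k : ℝ) ^ (-1 - β / 2 * s) :=
    Real.summable_nat_rpow.2 (by have := mul_pos (half_pos hβ) hs; linarith)
  have hle : ∀ k : ℕ, ((k : ℝ≥0∞) + 1)⁻¹ * tailBound p k ^ s ≤
      (if k ∈ Finset.range l₀ then 1 else 0) + ENNReal.ofReal ((k : ℝ) ^ (-1 - β / 2 * s)) := by
    intro k
    rcases lt_or_ge k l₀ with hk | hk
    · rw [if_pos (Finset.mem_range.2 hk)]
      refine le_trans ?_ le_self_add
      calc ((k : ℝ≥0∞) + 1)⁻¹ * tailBound p k ^ s ≤ 1 * 1 := by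
            gcongr
            · exact ENNReal.inv_le_one.2 le_add_self
            · exact ENNReal.rpow_le_one (hp.tailBound_le_one k) hs.le
        _ = 1 := one_mul 1
    · refine le_trans ?_ le_add_self
      obtain ⟨hk0, hk1⟩ := hl₀ k hk
      have hk0' : (0 : ℝ) < k := by exact_mod_cast hk0
      calc ((k : ℝ≥0∞) + 1)⁻¹ * tailBound p k ^ s
          ≤ (k : ℝ≥0∞)⁻¹ * ENNReal.ofReal ((k : ℝ) ^ (-β + β / 2)) ^ s := by
            gcongr
            exact le_self_add
        _ = ENNReal.ofReal ((k : ℝ)⁻¹ * ((k : ℝ) ^ (-β + β / 2)) ^ s) := by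
            rw [ENNReal.ofReal_mul (by positivity), ENNReal.ofReal_inv_of_pos hk0',
              ENNReal.ofReal_natCast, ENNReal.ofReal_rpow_of_nonneg (by positivity) hs.le]
        _ = ENNReal.ofReal ((k : ℝ) ^ (-1 - β / 2 * s)) := by
            rw [← Real.rpow_neg_one, ← Real.rpow_mul hk0'.le, ← Real.rpow_add hk0']
            congr 2
            ring
  refine ne_top_of_le_ne_top ?_ (ENNReal.tsum_le_tsum hle)
  rw [ENNReal.tsum_add, tsum_eq_sum (s := Finset.range l₀) fun k hk => if_neg hk]
  exact ENNReal.add_ne_top.2 ⟨ENNReal.sum_ne_top.2 fun k hk => by simp [Finset.mem_range.1 hk],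
    hsum.tsum_ofReal_ne_top⟩

/-- Halving the argument does not affect the polynomial decay. -/
lemma half (hp : HasPolynomialDecay p β) :
    HasPolynomialDecay (fun l : ℕ+ => (tailBound p ((l : ℕ) / 2)).toReal) β := by
  have h01 : ∀ l : ℕ, (tailBound p l).toReal ≤ 1 := fun l =>
    ENNReal.toReal_le_of_le_ofReal zero_le_one (by simpa using hp.tailBound_le_one l)
  refine ⟨fun l => ⟨ENNReal.toReal_nonneg, h01 _⟩, fun ε hε => ?_⟩
  suffices h : ∀ᶠ l : ℕ in atTop, (tailBound p (l / 2)).toReal ≤ (l : ℝ) ^ (-β + ε) from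
    (tendsto_atTop_mono (fun l : ℕ+ => le_rfl) tendsto_PNat_val_atTop_atTop).eventually h
  rcases le_or_gt β ε with hβ | hβ
  · filter_upwards [eventually_ge_atTop 1] with l hl
    exact (h01 _).trans (Real.one_le_rpow (by exact_mod_cast hl) (by linarith))
  · set γ := β - ε / 2 with hγ
    have hγ0 : 0 < γ := by linarith
    have hlim : Tendsto (fun l : ℕ => (l : ℝ) ^ (ε / 2)) atTop atTop :=
      (tendsto_rpow_atTop (half_pos hε)).comp tendsto_natCast_atTop_atTop
    have hhalf : Tendsto (fun l : ℕ => l / 2) atTop atTop :=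
      Nat.tendsto_div_const_atTop (by norm_num)
    filter_upwards [hhalf.eventually (hp.eventually_tailBound_le (half_pos hε)),
      hlim.eventually_ge_atTop (3 ^ γ), eventually_ge_atTop 2] with l hl h3 hl2
    have hl0 : (0 : ℝ) < l := by exact_mod_cast (by omega : 0 < l)
    have hm : (l : ℝ) / 3 ≤ ((l / 2 : ℕ) : ℝ) := by
      rw [div_le_iff₀ (by norm_num)]
      exact_mod_cast (by omega : l ≤ l / 2 * 3)
    calc (tailBound p (l / 2)).toReal ≤ ((l / 2 : ℕ) : ℝ) ^ (-β + ε / 2) :=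
          ENNReal.toReal_le_of_le_ofReal (by positivity) hl.2
      _ = ((l / 2 : ℕ) : ℝ) ^ (-γ) := by congr 1; rw [hγ]; ring
      _ ≤ ((l : ℝ) / 3) ^ (-γ) :=
          Real.rpow_le_rpow_of_nonpos (by positivity) hm (by linarith)
      _ = (l : ℝ) ^ (-γ) * 3 ^ γ := by
          rw [Real.div_rpow hl0.le (by norm_num), Real.rpow_neg (by norm_num : (0 : ℝ) ≤ 3),
            div_inv_eq_mul]
      _ ≤ (l : ℝ) ^ (-γ) * (l : ℝ) ^ (ε / 2) := by gcongr
      _ = (l : ℝ) ^ (-β + ε) := by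
          rw [← Real.rpow_add hl0, hγ]
          congr 1
          ring

end HasPolynomialDecay

lemma repairConst_ne_top {p : ℕ+ → ℝ} {β : ℝ} (hp : HasPolynomialDecay p β) (hβ : 0 < β)
    {C : ℝ≥0∞} (hC : C ≠ ∞) {s : ℝ} (hs0 : 0 < s) (hs1 : s ≤ 1) :
    repairConst (tailBound p) C s ≠ ∞ := by
  have h1 : ∑' c : ℕ, (2⁻¹ ^ c : ℝ≥0∞) ^ s ≠ ∞ := by
    have : ∀ c : ℕ, (2⁻¹ ^ c : ℝ≥0∞) ^ s = ((2⁻¹ : ℝ≥0∞) ^ s) ^ c := fun c => by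
      rw [← ENNReal.rpow_natCast, ← ENNReal.rpow_natCast, ← ENNReal.rpow_mul, ← ENNReal.rpow_mul,
        mul_comm]
    simp_rw [this]
    rw [ENNReal.tsum_geometric]
    refine ENNReal.inv_ne_top.2 (tsub_pos_of_lt ?_).ne'
    exact ENNReal.rpow_lt_one (by simp) hs0
  have h2 := hp.tsum_tailBound_ne_top hβ hs0
  unfold repairConst
  exact ENNReal.add_ne_top.2 ⟨ENNReal.one_ne_top, ENNReal.mul_ne_top
    (ENNReal.rpow_ne_top_of_nonneg (by linarith) hC) (ENNReal.add_ne_top.2 ⟨h1, h2⟩)⟩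

/-! ### Realization on an extension -/

/-- **Transfer.** If a law `Q` on a standard Borel space has the law of `X` as its image under `f`,
then, with the help of an independent uniform variable, `X` can be written as `f` of a variable
with law `Q`. -/
lemma exists_transfer {Ω E Y : Type*} [MeasurableSpace Ω] {P : Measure Ω} [IsProbabilityMeasure P]
    [MeasurableSpace E] [MeasurableSpace.CountablyGenerated E] [MeasurableEq E]
    [MeasurableSpace Y] [StandardBorelSpace Y] [Nonempty Y] {Q : Measure Y}
    [IsProbabilityMeasure Q] {X : Ω → E} (hX : Measurable X) {f : Y → E} (hf : Measurable f)
    (h : Q.map f = P.map X) :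
    ∃ Φ : Ω × I → Y, Measurable Φ ∧ (P.prod volume).map Φ = Q ∧
      ∀ᵐ ω ∂P.prod (volume : Measure I), f (Φ ω) = X ω.1 := by
  obtain ⟨g, hg, hgκ⟩ := (condDistrib id f Q).exists_measurable_map_eq_unitInterval
  have hΦ : Measurable fun ω : Ω × I => g (X ω.1) ω.2 :=
    hg.comp ((hX.comp measurable_fst).prodMk measurable_snd)
  have hpair : Measurable fun ω : Ω × I => (X ω.1, g (X ω.1) ω.2) :=
    (hX.comp measurable_fst).prodMk hΦ
  have hgraph : Measurable fun y : Y => (f y, y) := hf.prodMk measurable_id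
  have hgx : ∀ x, Measurable (g x) := fun x => hg.comp (measurable_const.prodMk measurable_id)
  have hlaw : (P.prod volume).map (fun ω : Ω × I => (X ω.1, g (X ω.1) ω.2)) =
      Q.map fun y => (f y, y) := by
    rw [← compProd_map_condDistrib (X := f) (Y := fun y : Y => y) measurable_id.aemeasurable, h]
    ext s hs
    rw [Measure.map_apply hpair hs, Measure.prod_apply (hpair hs), Measure.compProd_apply hs,
      lintegral_map (Kernel.measurable_kernel_prodMk_left hs) hX]
    refine lintegral_congr fun ω => ?_
    have := hgκ (X ω)
    rw [show condDistrib (fun y : Y => y) f Q = condDistrib id f Q from rfl, ← this,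
      Measure.map_apply (hgx _) (measurable_prodMk_left hs)]
    rfl
  refine ⟨fun ω => g (X ω.1) ω.2, hΦ, ?_, ?_⟩
  · have h1 := congrArg (Measure.map Prod.snd) hlaw
    rw [Measure.map_map measurable_snd hpair,
      Measure.map_map measurable_snd hgraph] at h1
    simpa [Function.comp_def] using h1
  · have hset : MeasurableSet {q : E × Y | f q.2 = q.1} :=
      measurableSet_eq_fun (hf.comp measurable_snd) measurable_fst
    have h2 : ∀ᵐ q ∂Q.map (fun y => (f y, y)), f q.2 = q.1 :=
      (ae_map_iff hgraph.aemeasurable hset).2 (ae_of_all _ fun y => rfl)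
    rw [← hlaw, ae_map_iff hpair.aemeasurable hset] at h2
    exact h2

/-! ### Quiltability of the limit -/

lemma IsBrownianLaw.measure_inter_pinned {hab : a < b} {W : Measure (PathSpace a b)}
    (hW : IsBrownianLaw hab W) (A : Set (PathSpace a b)) : W (A ∩ pinned hab) = W A := by
  refine measure_congr ?_
  filter_upwards [hW.start] with f hf
  exact propext ⟨fun h => h.1, fun h => ⟨h, hf⟩⟩

/-- The repaired quilt of a limit law, realized on an extension of the space of `X`. -/
lemma IsBrownianLaw.exists_realization {hab : a < b} {W : Measure (PathSpace a b)}
    (hW : IsBrownianLaw hab W) {Ω : Type*} [MeasurableSpace Ω] {P : Measure Ω}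
    [IsProbabilityMeasure P] {X : Ω → PathSpace a b} (hX : Measurable X)
    {μ : Measure (QuiltCode a b)} [IsProbabilityMeasure μ] (hμX : μ.map QuiltCode.path = P.map X)
    (hμ : ∀ᵐ z ∂μ, IsQuiltCode hab z) {p : ℕ → ℝ≥0∞} (hp : ∀ l, μ {z | l ≤ z.num} ≤ p l)
    {C₁ : ℝ≥0∞} {θ₁ : ℝ} (hθ₁ : 0 < θ₁)
    (hμ₁ : ∀ i A, MeasurableSet A → μ {z | z.fabric i ∈ A} ≤ C₁ * W A ^ θ₁) :
    ∃ (F : ℕ → Ω × I → PathSpace a b) (S : Ω × I → Finset ℝ),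
      (∀ i, Measurable (F i)) ∧ IsRandomFiniteSubset a b S ∧
      (∀ l : ℕ, (P.prod volume) {ω | l ≤ (S ω).card} ≤ p (l / 2)) ∧
      (∀ᵐ ω ∂P.prod (volume : Measure I), IsQuilt (fun i => F i ω) (S ω) (X ω.1)) ∧
      ∀ (C : ℝ≥0∞) (θ s : ℝ), 0 < θ → θ ≤ 1 → 0 ≤ s → s ≤ 1 →
        (∀ i A, MeasurableSet A → μ {z | z.fabric i ∈ A} ≤ C * W A ^ θ) →
        ∀ i A, MeasurableSet A → (P.prod volume) {ω | vshift hab (F i ω) ∈ A} ≤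
          repairConst p C s * W A ^ (θ * (1 - s)) := by
  have := hW.isProbabilityMeasure
  obtain ⟨d, hda, hdb, hd⟩ := hW.exists_germTimes hθ₁ hμ₁
  set Q : Measure (RepairSample a b) := μ.prod ((volume : Measure I).prod W) with hQ
  have hpath : Measurable fun ω : RepairSample a b => ω.1.path := measurable_path.comp measurable_fst
  have hQX : Q.map (fun ω => ω.1.path) = P.map X := by
    have h1 : Q.map Prod.fst = μ := by
      rw [hQ, Measure.map_fst_prod, measure_univ, one_smul]
    rw [← hμX, ← h1, Measure.map_map measurable_path measurable_fst]
    rfl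
  have hQcode : ∀ᵐ ω ∂Q, IsQuiltCode hab ω.1 := Measure.quasiMeasurePreserving_fst.ae hμ
  have : StandardBorelSpace I := measurableSet_Icc.standardBorel
  have : StandardBorelSpace (Set.Icc a b) := measurableSet_Icc.standardBorel
  have : StandardBorelSpace (PathSpace a b) := inferInstance
  have : StandardBorelSpace (QuiltCode a b) := inferInstance
  have : Nonempty (RepairSample a b) := ⟨((0, fun _ => 0, 0, fun _ => leftPt hab), 0, 0)⟩
  obtain ⟨Φ, hΦ, hΦQ, hΦX⟩ := exists_transfer hX hpath hQX
  have hcode : ∀ᵐ ω ∂P.prod (volume : Measure I), IsQuiltCode hab (Φ ω).1 := by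
    rw [← hΦQ] at hQcode
    exact ae_of_ae_map hΦ.aemeasurable hQcode
  have hlaw : ∀ s, MeasurableSet s → (P.prod volume) {ω | Φ ω ∈ s} = Q s := fun s hs => by
    rw [← hΦQ, Measure.map_apply hΦ hs]
    rfl
  have hconst : Measurable fun x : ℝ => (ContinuousMap.const _ x : PathSpace a b) :=
    ContinuousMap.continuous_const'.measurable
  have hS := isRandomFiniteSubset_stitchSet d
  refine ⟨fun i ω => repairedFabric d i (Φ ω) +
    ContinuousMap.const _ (if i = 0 then (Φ ω).1.path (leftPt hab) else 0),
    fun ω => stitchSet d (Φ ω), fun i => ?_, ?_, fun l => ?_, ?_, ?_⟩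
  · refine ((measurable_repairedFabric d i).comp hΦ).add (hconst.comp ?_)
    split_ifs
    · exact (measurable_eval _).comp (hpath.comp hΦ)
    · exact measurable_const
  · exact ⟨fun ω => hS.subset _, fun U hU => (hS.measurable_count U hU).comp hΦ⟩
  · -- there are at most `2 N + 1` stitch points
    have hcard : ∀ᵐ ω ∂P.prod (volume : Measure I), l ≤ (stitchSet d (Φ ω)).card →
        Φ ω ∈ {ω : RepairSample a b | l / 2 ≤ ω.1.num} := by
      filter_upwards [hcode] with ω hω hl
      rw [stitchSet, card_image_range (hω.strictMonoOn_stitch hda hdb), numStitch] at hl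
      have h1 := card_activeSet_le (Φ ω).1
      have h2 : shift (Φ ω) ≤ (Φ ω).1.num + 1 := by
        refine Nat.floor_le_of_le ?_
        push_cast
        have := (Φ ω).2.1.2
        exact mul_le_of_le_one_right (by positivity) this.2
      show l / 2 ≤ (Φ ω).1.num
      omega
    have hm : MeasurableSet {z : QuiltCode a b | l / 2 ≤ z.num} :=
      measurableSet_le measurable_const measurable_num
    calc (P.prod volume) {ω | l ≤ (stitchSet d (Φ ω)).card}
        ≤ (P.prod volume) {ω | Φ ω ∈ {ω : RepairSample a b | l / 2 ≤ ω.1.num}} :=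
          measure_mono_ae hcard
      _ = Q (Prod.fst ⁻¹' {z : QuiltCode a b | l / 2 ≤ z.num}) := hlaw _ (hm.preimage measurable_fst)
      _ = μ {z : QuiltCode a b | l / 2 ≤ z.num} :=
          (measurePreserving_fst (μ := μ) (ν := (volume : Measure I).prod W)).measure_preimage
            hm.nullMeasurableSet
      _ ≤ p (l / 2) := hp _
  · filter_upwards [hcode, hΦX] with ω hω hX'
    rw [← hX']
    exact hω.isQuilt_repaired hda hdb
  · intro C θ s hθ hθ1 hs0 hs1 hC i A hA
    refine le_trans (le_trans ?_ (hlaw _ (measurable_repairedFabric d i hA)).le)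
      (hW.prod_repairedFabric_le hθ hθ1 hC hp hd hs0 hs1 i hA)
    refine measure_mono_ae ?_
    filter_upwards [hcode] with ω hω hmem
    have h0 : repairedFabric d i (Φ ω) (leftPt hab) = 0 := hω.repairedFabric_mem_pinned d i
    have : vshift hab (repairedFabric d i (Φ ω) +
        ContinuousMap.const _ (if i = 0 then (Φ ω).1.path (leftPt hab) else 0)) =
        repairedFabric d i (Φ ω) := by
      ext x
      simp [vshift_apply, h0]
    show repairedFabric d i (Φ ω) ∈ A
    rw [← this]
    exact hmem

/-- With comparison exponent `β = 1` the comparison condition is void, and any path is a quilt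
without stitch points. -/
lemma isUniformlyQuiltableLimit_one {hab : a < b} {W : Measure (PathSpace a b)}
    (hW : IsBrownianLaw hab W) {Ω : Type u} [MeasurableSpace Ω] {J : Type*} (P : Measure Ω)
    {X : J → Ω → PathSpace a b} (hX : ∀ α, Measurable (X α)) (β₁ : ℝ) :
    IsUniformlyQuiltableLimit hab P X β₁ 1 := by
  refine ⟨fun _ => 0, ⟨fun _ => by simp, fun ε hε => Eventually.of_forall fun j => by positivity⟩,
    Ω, inferInstance, P, id, MeasurePreserving.id P, fun α _ => X α, fun _ _ => ∅,
    fun α _ => hX α, ⟨W, hW, fun η h0 h1 => ?_⟩, fun α => ⟨by simp, by simp⟩, fun α l => ?_,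
    fun α => ae_of_all _ fun ω => ⟨fun _ => 0, rfl, fun i _ x _ _ => by simp⟩⟩
  · norm_num at h1
    exact absurd h0 h1.not_gt
  · simp

end BrownianQuilt

open BrownianQuilt in
theorem proposition6p8 {a b : ℝ} (hab : a < b) {I : Type*}
    {Ω : Type*} [MeasurableSpace Ω] (P : Measure Ω) [IsProbabilityMeasure P]
    (X : ℕ+ → I → Ω → BrownianQuilt.PathSpace a b) (hX : ∀ n α, Measurable (X n α))
    (β₁ β₂ β₃ β₄ : ℝ) (hβ₁ : 0 < β₁) (hβ₂ : 1 ≤ β₂) (hβ₃ : 0 < β₃) (hβ₄ : 0 < β₄)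
    (hquilt : BrownianQuilt.IsUniformlyQuiltable hab P X β₁ β₂ β₃ β₄)
    (htight : ∀ α, IsTightMeasureSet (Set.range fun n : ℕ+ => P.map (X n α)))
    {Ω_lim : Type*} [MeasurableSpace Ω_lim] (P_lim : Measure Ω_lim) [IsProbabilityMeasure P_lim]
    (X_lim : I → Ω_lim → BrownianQuilt.PathSpace a b) (hX_lim : ∀ α, Measurable (X_lim α))
    (hlim : ∀ α, ∃ φ : ℕ → ℕ+, StrictMono φ ∧
      TendstoInDistribution (fun k => X (φ k) α) atTop (X_lim α) (fun _ => P) P_lim) :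
    BrownianQuilt.IsUniformlyQuiltableLimit hab P_lim X_lim β₁ β₂ := by
  obtain ⟨p, q, g, hp, hq, hg, Ω', _, P', π, hπ, E, F, S, hE, hF, ⟨W, hW, hcomp⟩, hS, hcard,
    hquilt⟩ := hquilt
  rcases hβ₂.eq_or_lt with rfl | hβ₂
  · exact isUniformlyQuiltableLimit_one hW P_lim hX_lim β₁
  have hWp := hW.isProbabilityMeasure
  have hP' : IsProbabilityMeasure P' := ⟨by
    rw [← Set.preimage_univ (f := π), hπ.measure_preimage nullMeasurableSet_univ, measure_univ]⟩
  have hβ : 0 < 1 - β₂⁻¹ := sub_pos.2 (inv_lt_one_of_one_lt₀ hβ₂)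
  have hβ' : 0 < β₂⁻¹ := inv_pos.2 (by linarith)
  choose! C₀ hC₀ using hcomp
  -- the limit law of the quilt codes, for each `α`
  have hcode : ∀ α, ∃ μ : Measure (QuiltCode a b), IsProbabilityMeasure μ ∧
      μ.map QuiltCode.path = P_lim.map (X_lim α) ∧ (∀ᵐ z ∂μ, IsQuiltCode hab z) ∧
      (∀ l, μ {z | l ≤ z.num} ≤ tailBound p l) ∧
      ∀ η, 0 < η → η < 1 - β₂⁻¹ → ∀ i A, MeasurableSet A →
        μ {z | z.fabric i ∈ A} ≤ ENNReal.ofReal (C₀ η) * W A ^ (1 - β₂⁻¹ - η) := by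
    intro α
    obtain ⟨φ, hφ, hφlim⟩ := hlim α
    have hφ' : Tendsto (fun k => ((φ k : ℕ+) : ℕ)) atTop atTop :=
      StrictMono.tendsto_atTop fun i j hij => hφ hij
    set Z : ℕ → Ω' → QuiltCode a b := fun k ω =>
      encode hab (fun i => F (φ k) α i ω) (S (φ k) α ω) (X (φ k) α (π ω)) with hZdef
    have hZ : ∀ k, Measurable (Z k) := fun k =>
      measurable_encode hab (hF _ _) (hS _ _) ((hX _ _).comp hπ.measurable)
    have hpath : ∀ k, (P'.map fun ω => (Z k ω).path) = P.map (X (φ k) α) := fun k => by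
      rw [← hπ.map_eq, Measure.map_map (hX _ _) hπ.measurable]
      rfl
    have hZcomp : ∀ η, 0 < η → η < 1 - β₂⁻¹ → ∀ i A, MeasurableSet A → W A ≠ 0 →
        ∀ᶠ k in atTop, P' {ω | (Z k ω).fabric i ∈ A} ≤
          ENNReal.ofReal (C₀ η) * W A ^ (1 - β₂⁻¹ - η) := by
      intro η h0 h1 i A hA hA0
      have hscale : Tendsto (fun k => Real.exp (-(g * ((φ k : ℕ) : ℝ) ^ β₄))) atTop (𝓝 0) :=
        Real.tendsto_exp_neg_atTop_nhds_zero.comp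
          (((tendsto_rpow_atTop hβ₄).comp (tendsto_natCast_atTop_atTop.comp hφ')).const_mul_atTop hg)
      have hpos : 0 < W.real (A ∩ pinned hab) := by
        rw [Measure.real, hW.measure_inter_pinned]
        exact ENNReal.toReal_pos hA0 (measure_ne_top _ _)
      filter_upwards [hscale.eventually (eventually_le_nhds hpos)] with k hk
      have := hC₀ η h0 h1 (φ k, α, i) (A ∩ pinned hab)
        (hA.inter (isClosed_pinned hab).measurableSet) Set.inter_subset_right hk
      have hset : {ω | (Z k ω).fabric i ∈ A} =
          {ω | vshift hab (F (φ k) α i ω) ∈ A ∩ pinned hab} := by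
        ext ω
        exact ⟨fun h => ⟨h, vshift_mem_pinned hab _⟩, fun h => h.1⟩
      rw [hset, ← ofReal_measureReal]
      refine (ENNReal.ofReal_le_ofReal this).trans ?_
      rw [ENNReal.ofReal_mul' (Real.rpow_nonneg measureReal_nonneg _),
        ← ENNReal.ofReal_rpow_of_nonneg measureReal_nonneg (by linarith), ofReal_measureReal,
        hW.measure_inter_pinned]
    have htightZ : IsTightMeasureSet (Set.range fun k => P'.map fun ω => (Z k ω).path) := by
      refine (htight α).subset ?_
      rintro _ ⟨k, rfl⟩
      exact ⟨φ k, (hpath k).symm⟩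
    have hnum : ∀ k l, P' {ω | l ≤ (Z k ω).num} ≤ tailBound p l := fun k l => by
      rcases Nat.eq_zero_or_pos l with rfl | hl
      · exact prob_le_one.trans_eq (by simp [tailBound])
      · rw [tailBound, dif_pos hl, ← ofReal_measureReal]
        exact ENNReal.ofReal_le_ofReal (hcard (φ k) α ⟨l, hl⟩)
    have hbad : ∀ k, P' {ω | ¬ IsQuiltCode hab (Z k ω)} ≤
        (tailBound q ∘ fun k => ((φ k : ℕ+) : ℕ)) k := fun k => by
      rw [Function.comp_apply, tailBound_coe]
      calc P' {ω | ¬ IsQuiltCode hab (Z k ω)} ≤ P' (E (φ k) α) := by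
            refine measure_mono_ae ?_
            filter_upwards [hquilt (φ k) α] with ω hω hnot
            by_contra hωE
            exact hnot ((hω hωE).isQuiltCode_encode ((hS _ _).subset ω))
        _ ≤ ENNReal.ofReal (q (φ k)) := by
            rw [← ofReal_measureReal]
            exact ENNReal.ofReal_le_ofReal (hE _ _).2
    obtain ⟨μ, hμ, hμX, hμcode, hμp, hμcomp⟩ := hW.exists_limit_code (ν :=
        ⟨P_lim.map (X_lim α), Measure.isProbabilityMeasure_map (hX_lim α).aemeasurable⟩)
      hZ htightZ (hp.tendsto_tailBound hβ₁) hnum ((hq.tendsto_tailBound hβ₃).comp hφ') hbad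
      (ENNReal.ofReal_ne_top (r := C₀ ((1 - β₂⁻¹) / 2))) (θ := 1 - β₂⁻¹ - (1 - β₂⁻¹) / 2)
      (by linarith) (hZcomp _ (by linarith) (by linarith))
      (hφlim.tendsto.congr fun k => Subtype.ext (hpath k).symm)
    exact ⟨μ, hμ, hμX, hμcode, hμp, fun η h0 h1 =>
      hμcomp _ _ ENNReal.ofReal_ne_top (by linarith) (hZcomp η h0 h1)⟩
  choose μ hμ hμX hμcode hμp hμcomp using hcode
  choose F' S' hF' hS' hcard' hquilt' hcomp' using fun α =>
    hW.exists_realization (hX_lim α) (hμX α) (hμcode α) (hμp α)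
      (θ₁ := 1 - β₂⁻¹ - (1 - β₂⁻¹) / 2) (by linarith)
      (hμcomp α ((1 - β₂⁻¹) / 2) (by linarith) (by linarith))
  refine ⟨_, hp.half, Ω_lim × unitInterval, inferInstance, P_lim.prod volume, Prod.fst,
    measurePreserving_fst, F', S', hF', ⟨W, hW, fun η h0 h1 => ?_⟩, hS', fun α l => ?_, hquilt'⟩
  · have hconst := repairConst_ne_top hp hβ₁ (C := ENNReal.ofReal (C₀ (η / 2)))
      ENNReal.ofReal_ne_top (half_pos h0) (by linarith)
    refine ⟨(repairConst (tailBound p) (ENNReal.ofReal (C₀ (η / 2))) (η / 2)).toReal,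
      fun j A hA _ _ => ?_⟩
    have := hcomp' j.1 _ (1 - β₂⁻¹ - η / 2) (η / 2) (by linarith) (by linarith) (by linarith)
      (by linarith) (hμcomp j.1 (η / 2) (by linarith) (by linarith)) j.2 A hA
    rw [Measure.real, Measure.real, ENNReal.toReal_rpow, ← ENNReal.toReal_mul]
    refine ENNReal.toReal_mono (ENNReal.mul_ne_top hconst
      (ENNReal.rpow_ne_top_of_nonneg (by linarith) (measure_ne_top _ _))) (this.trans ?_)
    exact mul_le_mul_right (ENNReal.rpow_le_rpow_of_exponent_ge (prob_le_one (μ := W) (s := A))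
      (by nlinarith)) _
  · exact ENNReal.toReal_mono (hp.tailBound_ne_top _) (hcard' α l)
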